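/- Let $B\to A$ be an injective finite ring homomorphism of Noetherian normal (i.e. integrally closed) domains of characteristic $0$ (for example, normal excellent domains), with fraction fields $M\subseteq F$. Assume that $A/B$ is a local complete intersection: for every prime $\mathfrak q$ of $A$ there is $g\in A\setminus\mathfrak q$ such that $A_g\cong B[T_1,\dots,T_n]/\langle f_1,\dots,f_r\rangle$ as $B$-algebras for some $n$ and some regular sequence $f_1,\dots,f_r$ in $B[T_1,\dots,T_n]$. Given a presentation $C=B[T_1,\dots,T_n]/I$ of a $B$-algebra $C$, put $$\omega_{C/B}=\operatorname{Hom}_C\Big(\textstyle\bigwedge^n_C I/I^2,\ \bigwedge^n_C\big(\Omega_{B[\underline T]/B}\otimes_{B[\underline T]}C\big)\Big)\ \ \big(=\det(I/I^2)^\vee\otimes_C\det(\Omega_{B[\underline T]/B}\otimes C)\text{ in the case at hand}\big),$$ and let $\delta^{\wedge n}\in\omega_{C/B}$ be the canonical element, the $n$-th exterior power of $\delta:I/I^2\to\Omega_{B[\underline T]/B}\otimes C$, $f\mapsto df\otimes 1$. Let $\omega_{A/B}$ be computed from any presentation $A=B[T_1,\dots,T_n]/I$, and let $\mathfrak C(A/B)=\{x\in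 F:\operatorname{Tr}_{F/M}(xA)\subseteq B\}$. Then: 1. $x\mapsto \operatorname{Tr}_{F/M}(x\,\cdot\,)$ is an isomorphism of $A$-modules $\mathfrak C(A/B)\cong\operatorname{Hom}_B(A,B)$. 2. There is exactly one isomorphism of $A$-modules $\omega_{A/B}\cong\mathfrak C(A/B)$ sending $\delta^{\wedge n}$ to $1$. Thus the dualizing module $\mathfrak C(A/B)=\operatorname{Hom}_B(A,B)$ is naturally isomorphic to the relative canonical module $\omega_{A/B}$. 3. The module $\omega_{A/B}$ is independent of the presentation and obtained by patching: for every $g\in A$ and every presentation $A_g=B[T_1,\dots,T_m]/I'$ there is exactly one isomorphism of $A_g$-modules from $A_g\otimes_A\omega_{A/B}$ to the module $\omega_{A_g/B}$ computed from that presentation which sends $1\otimes\delta^{\wedge n}$ to the canonical element $\delta^{\wedge m}$. -/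

import Mathlib

open scoped TensorProduct

noncomputable section

/-- `A` is a local complete intersection over `B`: every point of `Spec A` has a principal open
neighbourhood `Spec A_g` which is the closed subscheme of some affine space over `B` cut out by a
regular sequence. The length of the sequence is not required to be the number of variables. -/
def IsLocalCompleteIntersection (B A : Type*) [CommRing B] [CommRing A] [Algebra B A] : Prop :=
  ∀ q : Ideal A, q.IsPrime → ∃ g : A, g ∉ q ∧
    ∃ (n : ℕ) (Q : Algebra.Generators B (Localization.Away g) (Fin n))
      (fs : List (MvPolynomial (Fin n) B)),
      RingTheory.Sequence.IsRegular (MvPolynomial (Fin n) B) fs ∧ Q.ker = Ideal.ofList fs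

/-- The Grothendieck dualizing module `Hom_B(A, B)` of a finite algebra `A` over `B`. -/
def DualizingModule (B A : Type*) [CommRing B] [CommRing A] [Algebra B A] : Type _ :=
  A →ₗ[B] B

namespace DualizingModule

variable {B A : Type*} [CommRing B] [CommRing A] [Algebra B A]

instance : AddCommGroup (DualizingModule B A) := inferInstanceAs (AddCommGroup (A →ₗ[B] B))

instance : FunLike (DualizingModule B A) A B := inferInstanceAs (FunLike (A →ₗ[B] B) A B)

/-- `Hom_B(A, B)` is an `A`-module through its first argument: `(a • φ) x = φ (a * x)`. -/
instance : Module A (DualizingModule B A) where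
  smul a φ := LinearMap.comp (φ : A →ₗ[B] B) (LinearMap.mulLeft B a)
  one_smul φ := LinearMap.ext fun x => congrArg φ (one_mul x)
  mul_smul a b φ := LinearMap.ext fun x =>
    congrArg φ (show a * b * x = b * (a * x) by ring)
  smul_zero _ := rfl
  smul_add _ _ _ := rfl
  add_smul a b φ := LinearMap.ext fun x =>
    (congrArg φ (add_mul a b x)).trans (LinearMap.map_add (φ : A →ₗ[B] B) _ _)
  zero_smul φ := LinearMap.ext fun x =>
    (congrArg φ (zero_mul x)).trans (LinearMap.map_zero (φ : A →ₗ[B] B))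

end DualizingModule

/-- The codifferent `{x ∈ F | Tr_{F/M}(x A) ⊆ B}`, an `A`-submodule of `F`. -/
def codifferent (B A M F : Type*) [CommRing B] [CommRing A] [Field M] [Field F]
    [Algebra B M] [Algebra A F] [Algebra M F] : Submodule A F where
  carrier := {x | ∀ a : A, ∃ b : B, algebraMap B M b = Algebra.trace M F (x * algebraMap A F a)}
  zero_mem' a := ⟨0, by simp⟩
  add_mem' {x y} hx hy a := by
    obtain ⟨b, hb⟩ := hx a
    obtain ⟨c, hc⟩ := hy a
    exact ⟨b + c, by rw [map_add, hb, hc, add_mul, map_add]⟩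
  smul_mem' c x hx a := by
    obtain ⟨b, hb⟩ := hx (c * a)
    exact ⟨b, by rw [hb, map_mul (algebraMap A F), Algebra.smul_def]; congr 1; ring⟩

section Canonical

variable {B C : Type*} [CommRing B] [CommRing C] [Algebra B C] {n : ℕ}

/-- The relative canonical module of `C = B[T₁, …, Tₙ] / I` computed from this presentation `P`:
`Hom_C(det (I / I²), det (Ω_{B[T]/B} ⊗ C))`, where `det = ⋀ⁿ`. Here `P.toExtension.Cotangent` is
`I / I²` and `P.toExtension.CotangentSpace` is `C ⊗_{B[T]} Ω_{B[T]/B}`. It is meant for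
complete intersections of relative dimension `0`, where both modules have rank `n`. -/
abbrev CanonicalModule (P : Algebra.Generators B C (Fin n)) : Type _ :=
  (⋀[C]^n P.toExtension.Cotangent) →ₗ[C] (⋀[C]^n P.toExtension.CotangentSpace)

/-- The canonical element `⋀ⁿ δ` of the relative canonical module, where
`δ : I / I² → C ⊗ Ω_{B[T]/B}` sends the class of `f` to `1 ⊗ df`. -/
def canonicalElement (P : Algebra.Generators B C (Fin n)) : CanonicalModule P :=
  exteriorPower.map n P.toExtension.cotangentComplex

end Canonical

end

/-! Both modules are compared as submodules of F. Characteristic 0 makes F/M separable. Hence the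
trace form is nondegenerate, which identifies the codifferent with Hom_B(A, B), and F is formally
étale over B, so δ becomes an isomorphism over F. Dividing by δ^{∧n} therefore embeds ω in F; its
image is the set of c that multiply every Jacobian determinant of n elements of I into C
(`exists_canonicalEmbedding`). The point is to show that over C = A_g these are exactly the c with
g^k c in the codifferent for some k (`jacobianDet_mul_mem_iff`).

The codifferent satisfies the condition for any relations f. Write f(T) = b·(T − t) by Taylor
expansion; by Cramer's rule Δ = det b ∈ C ⊗ C is annihilated by the diagonal ideal, and
multiplication C ⊗ C → C sends it to the Jacobian J. Such an element has trace over the left factor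
equal to its product (`evalRight_trace_of_diagonal`). Contracting Δ with Tr(x ·), after clearing
denominators, gives J·x up to a power of g, and the contraction lies in C (`jacobianDet_mul_mem`).

Conversely, let 𝔞 be the ideal of all a with a·c in the codifferent. It suffices to exclude
associated primes q of A/𝔞 not containing g. Below such q, normality of B makes B_p a principal
ideal ring (`isPrincipalIdealRing_of_annihilator`), so A is locally free over B there. Near q there
is a presentation by as many relations as variables, and then Δ is nonzero in the fibre, being a
socle generator of a finite complete intersection (`MvPolynomial.mul_det_notMem`). By local freeness
some linear form Tr(x ·) detects it, so J·x is a unit at q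
(`exists_mem_codifferent_jacobianDet_mul_eq`). The condition on c passes to this presentation
because Jacobian determinants locally generate the zeroth Fitting ideal of Ω
(`mul_jacobianDet_mem_of_forall`). So c·J ∈ A_q, and c lies in the codifferent at q, a
contradiction.

Uniqueness is rank one: a map into F is determined by its value at the element sent to 1. -/

noncomputable section

/-! ### Determinants: Fitting ideals and Cramer's rule. -/

section Determinants

variable {R : Type*} [CommRing R]

/-- If all determinants of `m` rows taken in `K` lie in an ideal, then so does the determinant of
every larger square matrix whose rows begin with an element of `K`. -/
theorem Matrix.det_mem_of_forall_castAdd_mem {m : ℕ} (𝔟 : Ideal R) (K : Set (Fin m → R))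
    (h : ∀ v : Matrix (Fin m) (Fin m) R, (∀ i, v i ∈ K) → v.det ∈ 𝔟) (k : ℕ)
    (Z : Matrix (Fin (m + k)) (Fin (m + k)) R)
    (hZ : ∀ i, (fun j => Z i (Fin.castAdd k j)) ∈ K) : Z.det ∈ 𝔟 := by
  induction k with
  | zero => exact h Z hZ
  | succ k ih =>
    -- Expanding along the last column leaves the first m entries of every remaining row untouched.
    rw [Matrix.det_succ_column (n := m + k) Z (Fin.last (m + k))]
    refine Ideal.sum_mem _ fun i _ => Ideal.mul_mem_left _ _ (ih _ fun i' => ?_)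
    convert! hZ (i.succAbove i') using 2 with j
    simp only [Matrix.submatrix_apply, Fin.succAbove_last]
    rfl

/-- Comparison of the zeroth Fitting ideals computed from two finite generating families. -/
theorem Matrix.det_mem_of_relations {W : Type*} [AddCommGroup W] [Module R W] {m n : ℕ}
    (t : Fin m → W) (t' : Fin n → W) (ht : ∀ j, t j ∈ Submodule.span R (Set.range t'))
    (ht' : ∀ k, t' k ∈ Submodule.span R (Set.range t)) (𝔟 : Ideal R)
    (h : ∀ v : Matrix (Fin m) (Fin m) R, (∀ i, ∑ j, v i j • t j = 0) → v.det ∈ 𝔟)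
    (α : Matrix (Fin n) (Fin n) R) (hα : ∀ i, ∑ j, α i j • t' j = 0) : α.det ∈ 𝔟 := by
  simp only [Submodule.mem_span_range_iff_exists_fun] at ht ht'
  choose S' hS' using ht
  choose S hS using ht'
  let S : Matrix (Fin n) (Fin m) R := S
  let S' : Matrix (Fin m) (Fin n) R := S'
  have hmul {l : ℕ} (β : Matrix (Fin l) (Fin n) R) (i : Fin l) :
      ∑ j, (β * S) i j • t j = ∑ k, β i k • t' k := by
    simp only [Matrix.mul_apply, Finset.sum_smul, ← hS, Finset.smul_sum, smul_smul]
    exact Finset.sum_comm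
  -- The unipotent factors keep the determinant equal to det α, while the first m entries of every
  -- row become a relation between the t j: in the rows of 1 − S'S since S' and S rewrite t through
  -- t' and back, in those of αS since α consists of relations between the t' k.
  let Z : Matrix (Fin m ⊕ Fin n) (Fin m ⊕ Fin n) R :=
    Matrix.fromBlocks 1 (-S') 0 α * Matrix.fromBlocks 1 0 S 1
  have hZdet : Z.det = α.det := by
    rw [Matrix.det_mul, Matrix.det_fromBlocks_zero₂₁, Matrix.det_fromBlocks_zero₁₂]
    simp
  have hZ : Z = Matrix.fromBlocks (1 - S' * S) (-S') (α * S) α := by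
    simp [Z, Matrix.fromBlocks_multiply, sub_eq_add_neg]
  rw [← hZdet, ← Matrix.det_reindex_self finSumFinEquiv Z]
  refine Matrix.det_mem_of_forall_castAdd_mem 𝔟 {v | ∑ j, v j • t j = 0} (fun v hv => h v hv) n _
    fun i => ?_
  obtain ⟨i, rfl⟩ := finSumFinEquiv.surjective i
  simp only [Set.mem_ofPred_eq, Matrix.reindex_apply, Matrix.submatrix_apply,
    Equiv.symm_apply_apply, hZ, ← finSumFinEquiv_apply_left]
  rcases i with i | i
  · simp only [Matrix.fromBlocks_apply₁₁, Matrix.sub_apply, sub_smul, Finset.sum_sub_distrib, hmul]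
    simp [Matrix.one_apply, S', hS']
  · simp only [Matrix.fromBlocks_apply₂₁, hmul, hα]

/-- Cramer's rule modulo an ideal. -/
theorem Matrix.det_mul_mem_of_mulVec_mem {n : Type*} [Fintype n] [DecidableEq n] (I : Ideal R)
    (M : Matrix n n R) (x : n → R) (h : ∀ i, M.mulVec x i ∈ I) (j : n) : M.det * x j ∈ I := by
  have : M.det * x j = (M.adjugate.mulVec (M.mulVec x)) j := by
    rw [Matrix.mulVec_mulVec, Matrix.adjugate_mul, Matrix.smul_mulVec, Matrix.one_mulVec,
      Pi.smul_apply, smul_eq_mul]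
  rw [this]
  exact Ideal.sum_mem _ fun i _ => Ideal.mul_mem_left _ _ (h i)

/-- Replace row i by the k-th unit vector and apply Cramer's rule: the determinant is the cofactor
at (k, i), and row i contributes x k times the cofactor at (j, i). All other rows contribute
elements of I. This is the Koszul relation for a column of cofactors. -/
theorem Matrix.adjugate_mul_sub_mem {n : Type*} [Fintype n] [DecidableEq n] (I : Ideal R)
    (M : Matrix n n R) (x : n → R) (i : n) (h : ∀ l, l ≠ i → M.mulVec x l ∈ I) (j k : n) :
    x j * M.adjugate k i - x k * M.adjugate j i ∈ I := by
  set M' := M.updateRow i (Pi.single k 1) with hM'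
  have h1 : M.adjugate k i = M'.det := Matrix.adjugate_apply M k i
  have h2 : M.adjugate j i = M'.adjugate j i := by
    rw [Matrix.adjugate_apply, Matrix.adjugate_apply, hM', Matrix.updateRow_idem]
  have h3 : M'.det * x j = (M'.adjugate.mulVec (M'.mulVec x)) j := by
    rw [Matrix.mulVec_mulVec, Matrix.adjugate_mul, Matrix.smul_mulVec, Matrix.one_mulVec,
      Pi.smul_apply, smul_eq_mul]
  have h4 : M'.mulVec x i = x k := by
    simp [Matrix.mulVec, hM', dotProduct, Pi.single_apply]
  have h5 : x j * M.adjugate k i - x k * M.adjugate j i =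
      ∑ l ∈ Finset.univ.erase i, M'.adjugate j l * M'.mulVec x l := by
    rw [h1, h2, mul_comm (x j), h3]
    conv_lhs => rw [Matrix.mulVec, dotProduct, ← Finset.add_sum_erase _ _ (Finset.mem_univ i), h4]
    ring
  rw [h5]
  refine Ideal.sum_mem _ fun l hl => Ideal.mul_mem_left _ _ ?_
  have hl := Finset.ne_of_mem_erase hl
  have : M'.mulVec x l = M.mulVec x l := by
    simp [Matrix.mulVec, hM', Matrix.updateRow_ne hl]
  rw [this]
  exact h l hl

end Determinants

/-! ### The socle of a complete intersection at the origin. -/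

section Socle

variable {R : Type*} [CommRing R] {n : ℕ}

open MvPolynomial

/-- The relations between the variables are generated by the Koszul relations, tested against
linear maps. -/
theorem MvPolynomial.linearMap_eq_zero_of_koszul {W : Type*} [AddCommGroup W]
    [Module (MvPolynomial (Fin n) R) W] (w : Fin n → W)
    (hw : ∀ j k, (X j : MvPolynomial (Fin n) R) • w k = (X k : MvPolynomial (Fin n) R) • w j)
    (v : Fin n → MvPolynomial (Fin n) R) (hv : ∑ j, v j * X j = 0) : ∑ j, v j • w j = 0 := by
  classical
  let : Module R W := Module.compHom W (C : R →+* MvPolynomial (Fin n) R)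
  have hC (r : R) (y : W) : r • y = (C r : MvPolynomial (Fin n) R) • y := rfl
  -- θ divides a monomial by some variable X k occurring in it and multiplies by w k. By `hw` the
  -- choice of k is immaterial, so θ (p X j) = p • w j, and a relation between the X j becomes one
  -- between the w j.
  let θ : MvPolynomial (Fin n) R →ₗ[R] W := (basisMonomials (Fin n) R).constr R fun c =>
    if h : c.support.Nonempty then
      (monomial (c - Finsupp.single h.choose 1) (1 : R)) • w h.choose else 0
  have hθ (c : Fin n →₀ ℕ) (j : Fin n) : θ (monomial (c + Finsupp.single j 1) 1) =
      (monomial c (1 : R)) • w j := by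
    have hne : (c + Finsupp.single j 1).support.Nonempty := ⟨j, by simp⟩
    have : θ (monomial (c + Finsupp.single j 1) 1) =
        (monomial (c + Finsupp.single j 1 - Finsupp.single hne.choose 1) (1 : R)) •
          w hne.choose := by
      have := (basisMonomials (Fin n) R).constr_basis R (fun c =>
        if h : c.support.Nonempty then
        (monomial (c - Finsupp.single h.choose 1) (1 : R)) • w h.choose else (0 : W))
        (c + Finsupp.single j 1)
      rw [dif_pos hne] at this
      simpa [θ] using this
    rw [this]
    have hk := hne.choose_spec
    generalize hne.choose = k at hk ⊢
    by_cases hkj : k = j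
    · subst hkj; simp
    · have hck : Finsupp.single k 1 ≤ c := by
        rw [Finsupp.single_le_iff, Nat.one_le_iff_ne_zero]
        simpa [Finsupp.single_apply, Ne.symm hkj] using hk
      obtain ⟨c', rfl⟩ := exists_add_of_le hck
      rw [add_assoc, add_tsub_cancel_left, add_comm c', add_comm (Finsupp.single k 1) c',
        add_comm (Finsupp.single j 1)]
      have hm (i : Fin n) : (monomial (c' + Finsupp.single i 1) (1 : R)) =
          monomial c' 1 * X i := by simp [X, monomial_mul]
      rw [hm, hm, mul_smul, mul_smul, hw]
  have hθ' (p : MvPolynomial (Fin n) R) (j : Fin n) : θ (p * X j) = p • w j := by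
    induction p using MvPolynomial.induction_on' with
    | monomial c r =>
      have h1 : (monomial c r : MvPolynomial (Fin n) R) * X j =
          r • monomial (c + Finsupp.single j 1) 1 := by
        simp [X, monomial_mul, smul_monomial]
      rw [h1, map_smul, hθ, hC, smul_smul, C_mul_monomial, mul_one]
    | add p q hp hq => rw [add_mul, map_add, hp, hq, add_smul]
  rw [← Finset.sum_congr rfl fun j _ => hθ' (v j) j, ← map_sum, hv, map_zero]

/-- Replacing a matrix by another one with the same product with the vector of variables changes
the determinant by an element of the ideal generated by that product. -/
theorem MvPolynomial.det_sub_det_mem (I : Ideal (MvPolynomial (Fin n) R))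
    (D D' : Matrix (Fin n) (Fin n) (MvPolynomial (Fin n) R))
    (hD : ∀ i, D.mulVec X i ∈ I) (h : D.mulVec X = D'.mulVec X) : D.det - D'.det ∈ I := by
  classical
  -- Rows are exchanged one at a time: H S takes the rows in S from D' and the others from D, which
  -- does not change the product with X.
  let H (S : Finset (Fin n)) : Matrix (Fin n) (Fin n) (MvPolynomial (Fin n) R) :=
    fun i => if i ∈ S then D' i else D i
  have hH (S : Finset (Fin n)) : (H S).mulVec X = D.mulVec X := by
    ext1 i
    by_cases hi : i ∈ S
    · rw [h]; simp [H, Matrix.mulVec, hi]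
    · simp [H, Matrix.mulVec, hi]
  have key (S : Finset (Fin n)) : D.det - (H S).det ∈ I := by
    induction S using Finset.induction_on with
    | empty => simp [H]
    | insert i S hi ih =>
      have h1 : (H S) = (H (insert i S)).updateRow i (D i) := by
        ext1 l
        by_cases hl : l = i
        · subst hl; rw [Matrix.updateRow_self]; exact congrFun (if_neg hi)
        · rw [Matrix.updateRow_ne hl]; simp [H, hl]
      have h2 : H (insert i S) = (H (insert i S)).updateRow i (D' i) := by
        ext1 l
        by_cases hl : l = i
        · subst hl; rw [Matrix.updateRow_self]; exact congrFun (if_pos (Finset.mem_insert_self _ _))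
        · rw [Matrix.updateRow_ne hl]; exact fun _ => rfl
      set M := H (insert i S) with hM
      have h3 (v : Fin n → MvPolynomial (Fin n) R) :
          (M.updateRow i v).det = ∑ j, v j * M.adjugate j i := by
        simp_rw [Matrix.adjugate_apply, ← smul_eq_mul]
        have : v = ∑ j, v j • Pi.single j 1 := by
          ext1 j; simp [Finset.sum_apply, Pi.single_apply]
        conv_lhs => rw [this]
        exact map_sum ((Matrix.detRowAlternating (R := MvPolynomial (Fin n) R)).toMultilinearMap.toLinearMap M i) _ _ |>.trans
          (Finset.sum_congr rfl fun j _ => map_smul ((Matrix.detRowAlternating (R := MvPolynomial (Fin n) R)).toMultilinearMap.toLinearMap M i) _ _)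
      have h4 : (H S).det - M.det ∈ I := by
        rw [h1]; nth_rw 2 [h2]
        rw [h3, h3, ← Finset.sum_sub_distrib]
        simp_rw [← sub_mul]
        rw [← Ideal.Quotient.eq_zero_iff_mem, map_sum]
        -- The difference of the two i-th rows is a relation between the variables, and the
        -- cofactors of row i satisfy the Koszul relations modulo I.
        have := linearMap_eq_zero_of_koszul (W := MvPolynomial (Fin n) R ⧸ I)
          (fun j => Ideal.Quotient.mk I (M.adjugate j i)) (fun j k => ?_) (fun j => D i j - D' i j) ?_
        · exact (Finset.sum_congr rfl fun j _ => rfl).trans this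
        · have := Matrix.adjugate_mul_sub_mem I M X i (fun l _ => by rw [hM, hH]; exact hD l) j k
          rw [← Ideal.Quotient.eq] at this
          exact this
        · have := congrFun h i
          simp only [Matrix.mulVec, dotProduct] at this
          simp [sub_mul, this]
      convert I.add_mem ih h4 using 1
      ring
  have := key Finset.univ
  have hu : H Finset.univ = D' := by ext1 i; simp [H]
  rwa [hu] at this

/-- The determinant `det b` is a generator of the socle: if `f = b X` generates an ideal that is
primary to the origin near the origin, then `det b` is nonzero modulo `f` near the origin. -/
theorem MvPolynomial.mul_det_notMem {κ : Type*} [Field κ] (f : Fin n → MvPolynomial (Fin n) κ)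
    (b : Matrix (Fin n) (Fin n) (MvPolynomial (Fin n) κ)) (hf : f = b.mulVec X)
    (s s' : MvPolynomial (Fin n) κ) (hs : constantCoeff s ≠ 0) (hs' : constantCoeff s' ≠ 0)
    (N : ℕ) (hN : ∀ j, s * X j ^ N ∈ Ideal.span (Set.range f)) :
    s' * b.det ∉ Ideal.span (Set.range f) := by
  classical
  intro hmem
  -- The exponent is N + 1 so that ∏ X j ^ N survives modulo the powers X j ^ (N + 1). Both c·b and
  -- diag (s X j ^ N) send X to s X j ^ (N + 1), so their determinants agree modulo I. If s' det b
  -- were in (f), Cramer's rule for c would put s' det c det b, hence s' s ^ n ∏ X j ^ N, in I.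
  have hN' (j) : s * X j ^ (N + 1) ∈ Ideal.span (Set.range f) := by
    rw [pow_succ, ← mul_assoc]; exact Ideal.mul_mem_right _ _ (hN j)
  simp only [Ideal.mem_span_range_iff_exists_fun] at hN'
  choose c hc using hN'
  let c : Matrix (Fin n) (Fin n) (MvPolynomial (Fin n) κ) := c
  let I : Ideal (MvPolynomial (Fin n) κ) :=
    Ideal.span (Set.range fun j : Fin n => (X j : MvPolynomial (Fin n) κ) ^ (N + 1))
  have hX (j : Fin n) : (X j : MvPolynomial (Fin n) κ) ^ (N + 1) ∈ I :=
    Ideal.subset_span ⟨j, rfl⟩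
  have hcf : c.mulVec f = fun j => s * X j ^ (N + 1) := by
    ext1 j; exact hc j
  have h1 : (c * b).mulVec X = fun j => s * X j ^ (N + 1) := by
    rw [← Matrix.mulVec_mulVec, ← hf, hcf]
  have h2 : (c * b).det - (Matrix.diagonal fun j : Fin n => s * X j ^ N).det ∈ I := by
    refine det_sub_det_mem I _ _ (fun i => ?_) ?_
    · rw [h1]; exact I.mul_mem_left _ (hX i)
    · rw [h1]; ext1 j
      rw [Matrix.mulVec_diagonal, pow_succ, mul_assoc]
  have h3 : s' * (c * b).det ∈ I := by
    rw [Matrix.det_mul, mul_left_comm, mul_comm c.det]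
    obtain ⟨d, hd⟩ := Ideal.mem_span_range_iff_exists_fun.1 hmem
    rw [← hd, Finset.sum_mul]
    refine I.sum_mem fun j _ => ?_
    rw [mul_assoc, mul_comm (f j)]
    refine I.mul_mem_left _ (Matrix.det_mul_mem_of_mulVec_mem I c f (fun i => ?_) j)
    rw [hcf]; exact I.mul_mem_left _ (hX i)
  have h4 : s' * (s ^ n * ∏ j, X j ^ N) ∈ I := by
    have := I.sub_mem h3 (I.mul_mem_left s' h2)
    rw [mul_sub, sub_sub_cancel, Matrix.det_diagonal, Finset.prod_mul_distrib] at this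
    simpa using this
  let c₀ : Fin n →₀ ℕ := Finsupp.equivFunOnFinite.symm fun _ => N
  have h5 : ∏ j : Fin n, (X j : MvPolynomial (Fin n) κ) ^ N = monomial c₀ 1 := by
    rw [monomial_eq, Finsupp.prod_fintype _ _ (by simp)]; simp [c₀]
  have h6 : ∀ p ∈ I, coeff c₀ p = 0 := by
    intro p hp
    obtain ⟨d, rfl⟩ := Ideal.mem_span_range_iff_exists_fun.1 hp
    rw [coeff_sum]
    refine Finset.sum_eq_zero fun j _ => ?_
    rw [X_pow_eq_monomial, coeff_mul_monomial', if_neg]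
    intro hle
    have := hle j
    simp [c₀] at this
  have h7 := h6 _ h4
  rw [h5, ← mul_assoc, coeff_mul_monomial' , if_pos le_rfl, tsub_self, mul_one, ← constantCoeff_eq, map_mul,
    map_pow] at h7
  exact mul_ne_zero hs' (pow_ne_zero _ hs) h7

end Socle

/-! ### Traces of elements supported on the diagonal. -/

section Contraction

variable {B : Type*} [CommRing B]

/-- Evaluation of a linear form on the right factor of `S ⊗ A`. -/
def evalRight {A : Type*} [AddCommGroup A] [Module B A] (S : Type*) [CommRing S] [Algebra B S]
    (φ : A →ₗ[B] B) : S ⊗[B] A →ₗ[S] S :=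
  (TensorProduct.AlgebraTensorModule.rid B S S).toLinearMap ∘ₗ φ.baseChange S

@[simp]
theorem evalRight_tmul {A : Type*} [AddCommGroup A] [Module B A] {S : Type*} [CommRing S]
    [Algebra B S] (φ : A →ₗ[B] B) (s : S) (a : A) : evalRight S φ (s ⊗ₜ a) = φ a • s := by
  simp [evalRight]

/-- An element of `L ⊗ L` annihilated by the diagonal ideal has trace, over the left factor, equal
to its product. -/
theorem evalRight_trace_of_diagonal {K L : Type*} [Field K] [CommRing L] [Algebra K L]
    [Module.Finite K L] (z : L ⊗[K] L) (hz : ∀ a : L, (1 ⊗ₜ a) * z = (a ⊗ₜ 1) * z) :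
    evalRight L (Algebra.trace K L) z = Algebra.TensorProduct.lmul' K (S := L) z := by
  have h1 (y : L ⊗[K] L) :
      LinearMap.trace L (L ⊗[K] L) (LinearMap.mulLeft L y) =
        evalRight L (Algebra.trace K L) y := by
    induction y with
    | zero => simp
    | add y y' h h' =>
      rw [map_add, ← h, ← h', ← map_add]; congr 1; ext; simp [add_mul]
    | tmul s a =>
      have : LinearMap.mulLeft L (s ⊗ₜ[K] a) = s • (LinearMap.mulLeft K a).baseChange L := by
        ext x; simp [TensorProduct.smul_tmul']
      rw [this, map_smul, LinearMap.trace_baseChange, evalRight_tmul, Algebra.trace_apply]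
      rw [smul_eq_mul, Algebra.smul_def, mul_comm]
      rfl
  have h2 (w : L ⊗[K] L) : z * w = (Algebra.TensorProduct.lmul' K (S := L) w) • z := by
    induction w with
    | zero => simp
    | add y y' h h' => rw [mul_add, h, h', map_add, add_smul]
    | tmul s a =>
      have : s ⊗ₜ[K] a = (s ⊗ₜ 1) * (1 ⊗ₜ a) := by simp
      rw [mul_comm, this, mul_assoc, hz, ← mul_assoc]
      simp [Algebra.smul_def]
  let μ : L ⊗[K] L →ₗ[L] L :=
    { toFun := fun w => Algebra.TensorProduct.lmul' K (S := L) w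
      map_add' := map_add _
      map_smul' := fun l w => by
        induction w with
        | zero => simp
        | add y y' h h' => rw [smul_add, map_add, h, h', map_add, smul_add]
        | tmul s a => simp [TensorProduct.smul_tmul', mul_assoc] }
  have h3 : LinearMap.mulLeft L z = (LinearMap.toSpanSingleton L _ z) ∘ₗ μ := by
    refine LinearMap.ext fun w => ?_
    exact h2 w
  -- Multiplication by z factors through L as w ↦ μ w ↦ μ w • z. Its trace is that of the composite
  -- in the other order, which is multiplication by μ z on L.
  have h4 : μ ∘ₗ (LinearMap.toSpanSingleton L _ z) = LinearMap.mulLeft L (μ z) := by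
    ext; simp
  rw [← h1, h3, LinearMap.trace_comp_comm', h4]
  exact Algebra.trace_self_apply _

end Contraction

/-! ### A normality criterion for principal local rings. -/

section Normal

/-- A Noetherian integrally closed local domain `R` is a principal ideal ring as soon as its maximal
ideal multiplies some fraction `z ∉ R` into `R`. -/
theorem isPrincipalIdealRing_of_maximalIdeal_mul {R K : Type*} [CommRing R] [IsDomain R]
    [IsLocalRing R] [IsNoetherianRing R] [IsIntegrallyClosed R] [Field K] [Algebra R K]
    [IsFractionRing R K] (z : K) (hz : z ∉ (algebraMap R K).range)
    (h : ∀ a ∈ IsLocalRing.maximalIdeal R, algebraMap R K a * z ∈ (algebraMap R K).range) :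
    IsPrincipalIdealRing R := by
  have hinj := IsFractionRing.injective R K
  suffices h' : (IsLocalRing.maximalIdeal R).IsPrincipal from
    ((tfae_of_isNoetherianRing_of_isLocalRing_of_isDomain R).out 4 0).1 h'
  by_cases hu : ∃ a ∈ IsLocalRing.maximalIdeal R, ∃ u : R, IsUnit u ∧
      algebraMap R K u = algebraMap R K a * z
  · obtain ⟨a, ha, u, hu, huz⟩ := hu
    refine ⟨a, le_antisymm (fun b hb => ?_) ((Ideal.span_singleton_le_iff_mem _).2 ha)⟩
    obtain ⟨r, hr⟩ := h b hb
    obtain ⟨v, hv⟩ := hu.exists_left_inv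
    refine Ideal.mem_span_singleton'.2 ⟨r * v, hinj ?_⟩
    have hz0 : z ≠ 0 := by rintro rfl; exact hz ⟨0, by simp⟩
    have : algebraMap R K (u * b) = algebraMap R K (r * a) := by
      rw [map_mul, map_mul, hr, huz]; ring
    have := hinj this
    congr 1
    calc r * v * a = v * (r * a) := by ring
      _ = (v * u) * b := by rw [← this]; ring
      _ = b := by rw [hv, one_mul]
  -- If no product a z with a in the maximal ideal is a unit, z maps the maximal ideal into itself
  -- and is integral by the determinant trick. The trick needs a nonzero module, so the field case
  -- is separate.
  · push Not at hu
    exfalso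
    by_cases hbot : IsLocalRing.maximalIdeal R = ⊥
    · have hf : IsField R := IsLocalRing.isField_iff_maximalIdeal_eq.2 hbot
      obtain ⟨a, b, hb, rfl⟩ := IsFractionRing.div_surjective (A := R) z
      obtain ⟨c, hc⟩ := hf.mul_inv_cancel (nonZeroDivisors.ne_zero hb)
      refine hz ⟨a * c, ?_⟩
      have hb0 : algebraMap R K b ≠ 0 := by
        simpa using nonZeroDivisors.ne_zero hb
      rw [eq_div_iff hb0, ← map_mul, mul_assoc, mul_comm c, hc, mul_one]
    · let N : Submodule R K :=
        Submodule.map (Algebra.linearMap R K) (IsLocalRing.maximalIdeal R)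
      have hint : IsIntegral R z := by
        refine isIntegral_of_smul_mem_submodule (A := K) (M := K) N ?_ ?_ z ?_
        · obtain ⟨a, ha, ha0⟩ := Submodule.exists_mem_ne_zero_of_ne_bot hbot
          intro hN
          have : algebraMap R K a ∈ N := ⟨a, ha, rfl⟩
          rw [hN, Submodule.mem_bot] at this
          exact ha0 (by simpa using this)
        · exact (IsNoetherian.noetherian (IsLocalRing.maximalIdeal R)).map _
        · rintro _ ⟨a, ha, rfl⟩
          obtain ⟨r, hr⟩ := h a ha
          refine ⟨r, ?_, ?_⟩
          · rw [SetLike.mem_coe, IsLocalRing.mem_maximalIdeal]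
            exact fun hr' => hu a ha r hr' hr
          · rw [Algebra.linearMap_apply, hr, smul_eq_mul, mul_comm]; rfl
      obtain ⟨r, hr⟩ := IsIntegrallyClosed.isIntegral_iff.1 hint
      exact hz ⟨r, hr⟩

end Normal

/-! ### Taylor expansion and the determinant on the diagonal. -/

section Diagonal

open MvPolynomial

variable {B : Type*} [CommRing B] {m : ℕ}

/-- Taylor expansion at the point `t`. -/
def MvPolynomial.taylorAt {S : Type*} [CommRing S] [Algebra B S] (t : Fin m → S) :
    MvPolynomial (Fin m) B →ₐ[B] MvPolynomial (Fin m) S :=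
  aeval fun j => X j + C (t j)

variable {S : Type*} [CommRing S] [Algebra B S] (t : Fin m → S)

@[simp]
theorem MvPolynomial.taylorAt_X (j : Fin m) : taylorAt (B := B) t (X j) = X j + C (t j) := by
  simp [taylorAt]

theorem MvPolynomial.constantCoeff_taylorAt (p : MvPolynomial (Fin m) B) :
    constantCoeff (taylorAt t p) = aeval t p := by
  induction p using MvPolynomial.induction_on with
  | C r => simp
  | add p q hp hq => simp [hp, hq]
  | mul_X p j hp => simp [hp]

theorem MvPolynomial.constantCoeff_pderiv_taylorAt (p : MvPolynomial (Fin m) B) (k : Fin m) :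
    constantCoeff (pderiv k (taylorAt t p)) = aeval t (pderiv k p) := by
  classical
  induction p using MvPolynomial.induction_on with
  | C r => simp
  | add p q hp hq => simp [hp, hq]
  | mul_X p j hp =>
    simp only [map_mul, taylorAt_X, Derivation.leibniz, smul_eq_mul, map_add, pderiv_C, add_zero,
      pderiv_X, hp, constantCoeff_taylorAt, constantCoeff_X, zero_add, constantCoeff_C, aeval_X]
    by_cases hjk : j = k
    · subst hjk; simp
    · simp [hjk]

/-- A polynomial vanishing at t has a Taylor expansion without constant term, hence a combination of
the variables; differentiating at the origin identifies the constant terms of the coefficients. So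
det b specializes to the Jacobian determinant. -/
theorem MvPolynomial.exists_taylorAt_eq_mulVec (f : Fin m → MvPolynomial (Fin m) B)
    (hf : ∀ i, aeval t (f i) = 0) :
    ∃ b : Matrix (Fin m) (Fin m) (MvPolynomial (Fin m) S),
      (∀ i, taylorAt t (f i) = b.mulVec X i) ∧
        ∀ i j, constantCoeff (b i j) = aeval t (pderiv j (f i)) := by
  classical
  have h (i) : taylorAt t (f i) ∈
      Ideal.span (Set.range (X : Fin m → MvPolynomial (Fin m) S)) := by
    rw [← Set.image_univ, mem_ideal_span_X_image]
    intro c hc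
    by_contra! hc0
    have : c = 0 := by ext j; simpa using hc0 j
    subst this
    rw [mem_support_iff, ← constantCoeff_eq, constantCoeff_taylorAt, hf] at hc
    exact hc rfl
  simp only [Ideal.mem_span_range_iff_exists_fun] at h
  choose b hb using h
  have hb' (i : Fin m) : taylorAt t (f i) = Matrix.mulVec b X i := (hb i).symm
  refine ⟨b, hb', fun i j => ?_⟩
  rw [← constantCoeff_pderiv_taylorAt, ← hb i, map_sum, map_sum]
  rw [Finset.sum_eq_single j]
  · simp
  · intro k _ hk
    simp [Derivation.leibniz, pderiv_X, hk]
  · simp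

/-- The point of `S ⊗ A` with coordinates `1 ⊗ t - t ⊗ 1`, as a homomorphism on `S[X]`. -/
def diagonalEval {A : Type*} [CommRing A] [Algebra B A] (u : Fin m → A) :
    MvPolynomial (Fin m) S →ₐ[S] S ⊗[B] A :=
  aeval fun j => 1 ⊗ₜ u j - t j ⊗ₜ 1

variable {A : Type*} [CommRing A] [Algebra B A] (u : Fin m → A)

theorem diagonalEval_taylorAt (p : MvPolynomial (Fin m) B) :
    diagonalEval (B := B) t u (taylorAt t p) = 1 ⊗ₜ aeval u p := by
  have : ((diagonalEval (B := B) t u).restrictScalars B).comp (taylorAt t) =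
      Algebra.TensorProduct.includeRight.comp (aeval u) := by
    ext j
    simp only [AlgHom.comp_apply, AlgHom.restrictScalars_apply, taylorAt_X, map_add,
      Algebra.TensorProduct.includeRight_apply, aeval_X]
    rw [← MvPolynomial.algebraMap_eq, AlgHom.commutes]
    simp [diagonalEval, Algebra.TensorProduct.algebraMap_apply]
  exact DFunLike.congr_fun this p

/-- Cramer's rule: the determinant of `b` annihilates the diagonal ideal. -/
theorem diagonalEval_det_mul (u : Fin m → S) (hu : Function.Surjective (aeval (R := B) u))
    (f : Fin m → MvPolynomial (Fin m) B) (hf : ∀ i, aeval u (f i) = 0)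
    (b : Matrix (Fin m) (Fin m) (MvPolynomial (Fin m) S))
    (hb : ∀ i, taylorAt u (f i) = b.mulVec X i) (a : S) :
    (1 ⊗ₜ a) * diagonalEval (B := B) u u b.det = (a ⊗ₜ 1) * diagonalEval u u b.det := by
  obtain ⟨p, rfl⟩ := hu a
  have hX (j : Fin m) : diagonalEval (B := B) u u b.det * (1 ⊗ₜ u j - u j ⊗ₜ 1) = 0 := by
    have h := Matrix.det_mul_mem_of_mulVec_mem (RingHom.ker (diagonalEval (B := B) u u)) b X
      (fun i => by rw [← hb, RingHom.mem_ker, diagonalEval_taylorAt, hf, TensorProduct.tmul_zero]) j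
    rw [RingHom.mem_ker, map_mul] at h
    simpa [diagonalEval] using h
  induction p using MvPolynomial.induction_on with
  | C r =>
    have : (1 : S) ⊗ₜ[B] (algebraMap B S r) = (algebraMap B S r) ⊗ₜ 1 := by
      rw [Algebra.algebraMap_eq_smul_one, TensorProduct.smul_tmul]
    simp [this]
  | add p q hp hq =>
    rw [map_add, TensorProduct.tmul_add, TensorProduct.add_tmul, add_mul, add_mul, hp, hq]
  | mul_X p j hp =>
    have h1 : (1 : S) ⊗ₜ[B] (aeval u (p * X j)) = (1 ⊗ₜ aeval u p) * (1 ⊗ₜ u j) := by simp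
    have h2 : (aeval u (p * X j)) ⊗ₜ[B] (1 : S) = (aeval u p ⊗ₜ 1) * (u j ⊗ₜ 1) := by simp
    have h3 : (1 ⊗ₜ u j) * diagonalEval (B := B) u u b.det =
        (u j ⊗ₜ 1) * diagonalEval (B := B) u u b.det := by
      rw [← sub_eq_zero, ← sub_mul, mul_comm, hX]
    rw [h1, h2, mul_assoc, h3, mul_left_comm, hp]
    ring

/-- The coordinates 1 ⊗ u − u ⊗ 1 vanish on the diagonal. Applied to det b, this gives the Jacobian
determinant. -/
theorem lmul'_diagonalEval (u : Fin m → S) (p : MvPolynomial (Fin m) S) :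
    Algebra.TensorProduct.lmul' B (S := S) (diagonalEval u u p) = constantCoeff p := by
  induction p using MvPolynomial.induction_on with
  | C r =>
    rw [← MvPolynomial.algebraMap_eq, AlgHom.commutes]
    simp [Algebra.TensorProduct.algebraMap_apply]
  | add p q hp hq => simp [hp, hq]
  | mul_X p j hp => rw [map_mul, map_mul, hp]; simp [diagonalEval]

theorem map_diagonalEval {κ : Type*} [CommRing κ] [Algebra B κ] [Algebra S κ] [IsScalarTower B S κ]
    (p : MvPolynomial (Fin m) S) :
    Algebra.TensorProduct.map (IsScalarTower.toAlgHom B S κ) (AlgHom.id B A)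
      (diagonalEval t u p) =
    diagonalEval (fun j => algebraMap S κ (t j)) u (MvPolynomial.map (algebraMap S κ) p) := by
  induction p using MvPolynomial.induction_on with
  | C r =>
    rw [map_C, ← MvPolynomial.algebraMap_eq, AlgHom.commutes, ← MvPolynomial.algebraMap_eq,
      AlgHom.commutes]
    simp [Algebra.TensorProduct.algebraMap_apply]
  | add p q hp hq => simp [hp, hq]
  | mul_X p j hp => rw [map_mul, map_mul, hp]; simp [diagonalEval]

theorem map_taylorAt {κ : Type*} [CommRing κ] [Algebra B κ] [Algebra S κ] [IsScalarTower B S κ]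
    (p : MvPolynomial (Fin m) B) :
    MvPolynomial.map (algebraMap S κ) (taylorAt t p) =
      taylorAt (fun j => algebraMap S κ (t j)) p := by
  induction p using MvPolynomial.induction_on with
  | C r => simp [← IsScalarTower.algebraMap_apply]
  | add p q hp hq => simp [hp, hq]
  | mul_X p j hp => simp [hp]

theorem diagonalEval_surjective (hu : Function.Surjective (aeval (R := B) u)) :
    Function.Surjective (diagonalEval (B := B) t u) := by
  intro z
  induction z with
  | zero => exact ⟨0, map_zero _⟩
  | add y z hy hz =>
    obtain ⟨p, rfl⟩ := hy
    obtain ⟨q, rfl⟩ := hz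
    exact ⟨p + q, map_add _ _ _⟩
  | tmul s a =>
    obtain ⟨p, rfl⟩ := hu a
    refine ⟨C s * taylorAt t p, ?_⟩
    rw [map_mul, diagonalEval_taylorAt, ← MvPolynomial.algebraMap_eq, AlgHom.commutes]
    simp [Algebra.TensorProduct.algebraMap_apply]

/-- Presentations are stable under base change, and the origin of affine space over S may be moved
to the point t. Thus the fibre is again presented by the translated relations. -/
theorem ker_diagonalEval (hu : Function.Surjective (aeval (R := B) u)) {ι : Type*}
    (f : ι → MvPolynomial (Fin m) B)
    (hker : RingHom.ker (aeval (R := B) u) = Ideal.span (Set.range f)) :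
    RingHom.ker (diagonalEval (B := B) t u) = Ideal.span (Set.range fun i => taylorAt t (f i)) := by
  set J := Ideal.span (Set.range fun i => taylorAt t (f i)) with hJ
  refine le_antisymm ?_ ?_
  · let g : MvPolynomial (Fin m) B →ₐ[B] MvPolynomial (Fin m) S ⧸ J :=
      (Ideal.Quotient.mkₐ B J).comp (taylorAt t)
    have hg : ∀ p ∈ RingHom.ker (aeval (R := B) u), g p = 0 := by
      rw [hker]
      intro p hp
      have : Ideal.span (Set.range f) ≤ RingHom.ker g := by
        rw [Ideal.span_le]
        rintro _ ⟨i, rfl⟩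
        exact Ideal.Quotient.eq_zero_iff_mem.2 (Ideal.subset_span ⟨i, rfl⟩)
      exact this hp
    let h : A →ₐ[B] MvPolynomial (Fin m) S ⧸ J :=
      (Ideal.Quotient.liftₐ _ g hg).comp
        (Ideal.quotientKerAlgEquivOfSurjective hu).symm.toAlgHom
    have hh (p : MvPolynomial (Fin m) B) : h (aeval u p) = g p := by
      have : (Ideal.quotientKerAlgEquivOfSurjective hu).symm (aeval u p) =
          Ideal.Quotient.mk _ p := by
        rw [AlgEquiv.symm_apply_eq]; rfl
      simp only [h, AlgHom.comp_apply]
      erw [this]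
      rfl
    -- H is a left inverse of `diagonalEval` modulo J, so the kernel is no larger than J.
    let H : S ⊗[B] A →ₐ[S] MvPolynomial (Fin m) S ⧸ J :=
      Algebra.TensorProduct.lift (Algebra.ofId S _) h fun _ _ => Commute.all _ _
    have hH : H.comp (diagonalEval (B := B) t u) = Ideal.Quotient.mkₐ S J := by
      refine MvPolynomial.algHom_ext fun j => ?_
      have := hh (X j)
      rw [aeval_X] at this
      simp only [AlgHom.comp_apply, diagonalEval, aeval_X, map_sub, H,
        Algebra.TensorProduct.lift_tmul, map_one, one_mul, this, mul_one, g, taylorAt_X]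
      rw [map_add, add_sub_assoc]
      convert add_zero _
      · rw [sub_eq_zero]
        rfl
      · rfl
    intro p hp
    rw [RingHom.mem_ker] at hp
    have := DFunLike.congr_fun hH p
    rw [AlgHom.comp_apply, hp, map_zero] at this
    exact Ideal.Quotient.eq_zero_iff_mem.1 this.symm
  · rw [hJ, Ideal.span_le]
    rintro _ ⟨i, rfl⟩
    have : f i ∈ RingHom.ker (aeval (R := B) u) := hker ▸ Ideal.subset_span ⟨i, rfl⟩
    rw [RingHom.mem_ker] at this
    rw [SetLike.mem_coe, RingHom.mem_ker, diagonalEval_taylorAt, this, TensorProduct.tmul_zero]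

/-- The determinant of `b` is nonzero in the fibre through the given point, when that fibre is
finite. -/
theorem map_diagonalEval_det_ne_zero {κ : Type*} [Field κ] [Algebra B κ] [Algebra S κ]
    [IsScalarTower B S κ] [Module.Finite κ (κ ⊗[B] S)] (u : Fin m → S)
    (hu : Function.Surjective (aeval (R := B) u)) (f : Fin m → MvPolynomial (Fin m) B)
    (hker : RingHom.ker (aeval (R := B) u) = Ideal.span (Set.range f))
    (b : Matrix (Fin m) (Fin m) (MvPolynomial (Fin m) S))
    (hb : ∀ i, taylorAt u (f i) = b.mulVec X i) :
    Algebra.TensorProduct.map (IsScalarTower.toAlgHom B S κ) (AlgHom.id B S)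
      (diagonalEval u u b.det) ≠ 0 := by
  rw [map_diagonalEval]
  set t := fun j => algebraMap S κ (u j)
  let b' := b.map (MvPolynomial.map (algebraMap S κ))
  have hb' : (fun i => taylorAt t (f i)) = b'.mulVec X := by
    ext1 i
    rw [← map_taylorAt, hb]
    simp [Matrix.mulVec, dotProduct, b', map_sum]
  have hdet : MvPolynomial.map (algebraMap S κ) b.det = b'.det := by
    rw [RingHom.map_det]; rfl
  have hK := ker_diagonalEval t u hu f hker
  -- The rational point of the fibre defined by S → κ; in the translated coordinates it is the
  -- origin.
  let μ : κ ⊗[B] S →ₐ[κ] κ :=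
    Algebra.TensorProduct.lift (AlgHom.id κ κ) (IsScalarTower.toAlgHom B S κ)
      fun _ _ => Commute.all _ _
  have hμ (p : MvPolynomial (Fin m) κ) : μ (diagonalEval (B := B) t u p) = constantCoeff p := by
    have : μ.comp (diagonalEval (B := B) t u) = aeval 0 := by
      refine MvPolynomial.algHom_ext fun j => ?_
      simp [diagonalEval, μ, t]
    have h2 := DFunLike.congr_fun this p
    rw [AlgHom.comp_apply] at h2
    rw [h2, constantCoeff_eq, ← MvPolynomial.constantCoeff_eq]
    simp [aeval_zero]
  let 𝔫 := RingHom.ker μ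
  have : IsArtinianRing (κ ⊗[B] S) := .of_finite κ _
  -- The finite fibre is Artinian, so the powers of 𝔫 stabilize, and Nakayama's lemma gives r ≡ 1
  -- modulo 𝔫 killing 𝔫 ^ N. A polynomial s lifting r is nonzero at the origin and puts every s X j
  -- ^ N in the ideal of the fibre, as the socle lemma requires.
  obtain ⟨N, hN⟩ := IsArtinian.monotone_stabilizes (R := κ ⊗[B] S) (M := κ ⊗[B] S)
    ⟨fun k => OrderDual.toDual (𝔫 ^ k), fun _ _ h => Ideal.pow_le_pow_right h⟩
  have hN1 : 𝔫 ^ N = 𝔫 * 𝔫 ^ N := by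
    rw [← pow_succ']
    exact hN (N + 1) (Nat.le_succ N)
  obtain ⟨r, hr1, hr⟩ := Submodule.exists_sub_one_mem_and_smul_eq_zero_of_fg_of_le_smul 𝔫 (𝔫 ^ N)
    (IsNoetherian.noetherian _) hN1.le
  obtain ⟨s, rfl⟩ := diagonalEval_surjective t u hu r
  have hs : constantCoeff s ≠ 0 := by
    rw [RingHom.mem_ker, map_sub, hμ, map_one, sub_eq_zero] at hr1
    rw [hr1]; exact one_ne_zero
  intro h0
  refine MvPolynomial.mul_det_notMem _ b' hb' s 1 hs (by simp) N (fun j => ?_) ?_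
  · rw [← hK, RingHom.mem_ker, map_mul, map_pow]
    refine hr _ (Ideal.pow_mem_pow ?_ N)
    rw [RingHom.mem_ker, hμ, constantCoeff_X]
  · rw [← hK, RingHom.mem_ker, one_mul, ← hdet, h0]

end Diagonal

/-! ### The canonical module as a fractional ideal. -/

section CanonicalEmbedding

open MvPolynomial

variable {B C : Type*} [CommRing B] [CommRing C] [Algebra B C] {n : ℕ}

/-- The Jacobian determinant of `n` polynomials at the point given by a presentation. -/
def Algebra.Generators.jacobianDet (P : Algebra.Generators B C (Fin n))
    (f : Fin n → MvPolynomial (Fin n) B) : C :=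
  (Matrix.of fun i j => aeval P.val (pderiv j (f i))).det

section TopPower

variable {W N : Type*} [AddCommGroup W] [Module C W] [AddCommGroup N] [Module C N]
  (v : Module.Basis (Fin n) C W)

theorem AlternatingMap.apply_eq_det_smul (g : W [⋀^Fin n]→ₗ[C] N) (w : Fin n → W) :
    g w = v.det w • g v := by
  have : g = (LinearMap.toSpanSingleton C N (g v)).compAlternatingMap v.det := by
    refine Module.Basis.ext_alternating v fun σ hσ => ?_
    let τ : Equiv.Perm (Fin n) := Equiv.ofBijective σ (Finite.injective_iff_bijective.1 hσ)
    have h1 := g.map_perm v τ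
    have h2 := v.det.map_perm v τ
    change g (v ∘ τ) = (LinearMap.toSpanSingleton C N (g v)) (v.det (v ∘ τ))
    rw [h1, h2, Module.Basis.det_self]
    simp
  conv_lhs => rw [this]
  rfl

/-- The trivialization of the top exterior power by a basis. -/
def Module.Basis.topPower : ⋀[C]^n W →ₗ[C] C :=
  exteriorPower.alternatingMapLinearEquiv v.det

@[simp]
theorem Module.Basis.topPower_ιMulti (w : Fin n → W) :
    v.topPower (exteriorPower.ιMulti C n w) = v.det w :=
  exteriorPower.alternatingMapLinearEquiv_apply_ιMulti _ _

theorem Module.Basis.topPower_smul (z : ⋀[C]^n W) :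
    v.topPower z • exteriorPower.ιMulti C n v = z := by
  have : (LinearMap.toSpanSingleton C _ (exteriorPower.ιMulti C n v)) ∘ₗ v.topPower =
      LinearMap.id := by
    refine exteriorPower.linearMap_ext (AlternatingMap.ext fun w => ?_)
    rw [LinearMap.compAlternatingMap_apply, LinearMap.comp_apply, v.topPower_ιMulti]
    exact (AlternatingMap.apply_eq_det_smul v (exteriorPower.ιMulti C n) w).symm
  exact DFunLike.congr_fun this z

end TopPower

variable (P : Algebra.Generators B C (Fin n))

theorem topPower_canonicalElement_mk (f : Fin n → P.toExtension.ker) :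
    P.cotangentSpaceBasis.topPower (canonicalElement P
      (exteriorPower.ιMulti C n fun i => Algebra.Extension.Cotangent.mk (f i))) =
      P.jacobianDet fun i => (f i).1 := by
  rw [canonicalElement, exteriorPower.map_apply_ιMulti, Module.Basis.topPower_ιMulti,
    Module.Basis.det_apply]
  refine (Matrix.det_transpose _).symm.trans (congrArg Matrix.det ?_)
  ext i j
  simp only [Matrix.transpose_apply, Module.Basis.toMatrix_apply, Function.comp_apply,
    Algebra.Extension.cotangentComplex_mk, Matrix.of_apply]
  exact P.cotangentSpaceBasis_repr_one_tmul _ _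

/-- The kernel of δ is H₁ of the cotangent complex. Its localization at the generic point is that of
F over B, which vanishes because F is formally étale over B. -/
theorem exists_smul_eq_zero_of_cotangentComplex_eq_zero [IsDomain C] (F : Type*) [Field F]
    [Algebra C F] [IsFractionRing C F] [Algebra B F] [IsScalarTower B C F]
    [Algebra.FormallyEtale B F] (x : P.toExtension.Cotangent)
    (hx : P.toExtension.cotangentComplex x = 0) : ∃ s : C, s ≠ 0 ∧ s • x = 0 := by
  let y : P.toExtension.H1Cotangent := ⟨x, hx⟩
  have : Subsingleton (Algebra.H1Cotangent B F) := inferInstance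
  obtain ⟨s, hs⟩ := (IsLocalizedModule.eq_zero_iff (nonZeroDivisors C)
    (Algebra.H1Cotangent.map B B C F)).1 (Subsingleton.elim
      (Algebra.H1Cotangent.map B B C F (P.equivH1Cotangent y)) 0)
  refine ⟨s, nonZeroDivisors.ne_zero s.2, ?_⟩
  have h2 : P.equivH1Cotangent ((s : C) • y) = 0 := by rw [map_smul]; exact hs
  rw [LinearEquiv.map_eq_zero_iff] at h2
  exact congrArg Subtype.val h2

/-- Differentials localize, and those of the formally étale algebra F vanish. -/
theorem exists_smul_kaehler_eq_zero [IsDomain C] (F : Type*) [Field F]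
    [Algebra C F] [IsFractionRing C F] [Algebra B F] [IsScalarTower B C F]
    [Algebra.FormallyEtale B F] (y : Ω[C⁄B]) : ∃ s : C, s ≠ 0 ∧ s • y = 0 := by
  have : Subsingleton (Ω[F⁄B]) := inferInstance
  obtain ⟨s, hs⟩ := (IsLocalizedModule.eq_zero_iff (nonZeroDivisors C)
    (KaehlerDifferential.map B B C F)).1 (Subsingleton.elim
      (KaehlerDifferential.map B B C F y) 0)
  exact ⟨s, nonZeroDivisors.ne_zero s.2, hs⟩

/-- Up to torsion the top exterior power of the conormal module has rank one, and the canonical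
element is generically nonzero. -/
theorem exists_generic_generator [IsDomain C] (F : Type*) [Field F]
    [Algebra C F] [IsFractionRing C F] [Algebra B F] [IsScalarTower B C F]
    [Algebra.FormallyEtale B F] :
    ∃ ν : ⋀[C]^n P.toExtension.Cotangent,
      P.cotangentSpaceBasis.topPower (canonicalElement P ν) ≠ 0 ∧
        ∀ ν' : ⋀[C]^n P.toExtension.Cotangent, ∃ s c : C, s ≠ 0 ∧ s • ν' = c • ν := by
  classical
  set v := P.cotangentSpaceBasis
  have h1 (j : Fin n) : ∃ (s : C) (x : P.toExtension.Cotangent), s ≠ 0 ∧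
      P.toExtension.cotangentComplex x = s • v j := by
    obtain ⟨s, hs, h⟩ := exists_smul_kaehler_eq_zero F (P.toExtension.toKaehler (v j))
    rw [← map_smul] at h
    obtain ⟨x, hx⟩ := (P.toExtension.exact_cotangentComplex_toKaehler _).1 h
    exact ⟨s, x, hs, hx⟩
  choose s x hs hx using h1
  -- A common multiple of the s j, so that δ (y j) is the same multiple r of every basis vector. The
  -- y j then form a basis of I/I² up to torsion, and their wedge is ν.
  let r := ∏ j, s j
  have hr : r ≠ 0 := Finset.prod_ne_zero_iff.2 fun j _ => hs j
  have hr' (j : Fin n) : r = (∏ i ∈ Finset.univ.erase j, s i) * s j :=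
    (Finset.prod_erase_mul _ _ (Finset.mem_univ j)).symm
  let y (j : Fin n) : P.toExtension.Cotangent := (∏ i ∈ Finset.univ.erase j, s i) • x j
  have hy (j : Fin n) : P.toExtension.cotangentComplex (y j) = r • v j := by
    rw [map_smul, hx, smul_smul, ← hr']
  have h2 (z : P.toExtension.Cotangent) : ∃ (a : C) (c : Fin n → C), a ≠ 0 ∧
      a • z = ∑ j, c j • y j := by
    let d := v.repr (P.toExtension.cotangentComplex z)
    have h3 : P.toExtension.cotangentComplex (r • z - ∑ j, d j • y j) = 0 := by
      rw [map_sub, map_smul, map_sum, sub_eq_zero]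
      conv_lhs => rw [← v.sum_repr (P.toExtension.cotangentComplex z), Finset.smul_sum]
      refine Finset.sum_congr rfl fun j _ => ?_
      rw [map_smul, hy, smul_comm]
    obtain ⟨a, ha, h4⟩ := exists_smul_eq_zero_of_cotangentComplex_eq_zero P F _ h3
    refine ⟨a * r, fun j => a * d j, mul_ne_zero ha hr, ?_⟩
    rw [smul_sub, sub_eq_zero, smul_smul, Finset.smul_sum] at h4
    simpa only [smul_smul] using h4
  refine ⟨exteriorPower.ιMulti C n y, ?_, fun ν' => ?_⟩
  · have : (fun i => P.toExtension.cotangentComplex (y i)) = fun i => r • v i := funext hy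
    rw [canonicalElement, exteriorPower.map_apply_ιMulti, Module.Basis.topPower_ιMulti]
    change v.det (fun i => P.toExtension.cotangentComplex (y i)) ≠ 0
    rw [this, v.det.map_smul_univ (fun _ => r) v, v.det_self]
    simp [hr]
  · have hmem : ν' ∈ Submodule.span C (Set.range (exteriorPower.ιMulti C n
        (M := P.toExtension.Cotangent))) := by
      rw [exteriorPower.ιMulti_span]; trivial
    induction hmem using Submodule.span_induction with
    | zero => exact ⟨1, 0, one_ne_zero, by simp⟩
    | add a b _ _ ha hb =>
      obtain ⟨s, c, hs, h⟩ := ha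
      obtain ⟨s', c', hs', h'⟩ := hb
      refine ⟨s * s', s' * c + s * c', mul_ne_zero hs hs', ?_⟩
      rw [smul_add, mul_comm s, mul_smul, h, mul_comm s', mul_smul, h', add_smul, mul_smul,
        mul_smul]
    | smul a z _ hz =>
      obtain ⟨s, c, hs, h⟩ := hz
      exact ⟨s, a * c, hs, by rw [smul_comm, h, mul_smul]⟩
    | mem z hz =>
      obtain ⟨w, rfl⟩ := hz
      choose a c ha hc using fun i => h2 (w i)
      -- With a i • w i = ∑ c i j • y j, the product of the a i times the wedge of w is det c times
      -- the wedge of y.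
      let g : (Fin n → C) [⋀^Fin n]→ₗ[C] (⋀[C]^n P.toExtension.Cotangent) :=
        (exteriorPower.ιMulti C n).compLinearMap (Fintype.linearCombination C y)
      refine ⟨∏ i, a i, (Pi.basisFun C (Fin n)).det c, Finset.prod_ne_zero_iff.2 fun i _ => ha i,
        ?_⟩
      have h3 := AlternatingMap.apply_eq_det_smul (Pi.basisFun C (Fin n)) g c
      have h4 : g (Pi.basisFun C (Fin n)) = exteriorPower.ιMulti C n y := by
        refine congrArg (exteriorPower.ιMulti C n) (funext fun j => ?_)
        simp [Fintype.linearCombination_apply, Pi.single_apply]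
      have h5 : g c = exteriorPower.ιMulti C n fun i => a i • w i := by
        refine congrArg (exteriorPower.ιMulti C n) (funext fun j => ?_)
        rw [Fintype.linearCombination_apply, hc]
      rw [← h4, ← h3, h5, AlternatingMap.map_smul_univ]

/-- For a module `N` of rank one up to torsion and a free module `L` of rank one, `Hom (N, L)` embeds
in the fraction field by comparison with a given homomorphism which is generically nonzero. -/
theorem exists_homEmbedding [IsDomain C] (F : Type*) [Field F] [Algebra C F] [IsFractionRing C F]
    {N L : Type*} [AddCommGroup N] [Module C N] [AddCommGroup L] [Module C L] (ℓ : L →ₗ[C] C)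
    (l : L) (hℓ : ∀ z, ℓ z • l = z) (hl : ℓ l = 1) (δ : N →ₗ[C] L) (ν : N) (hν : ℓ (δ ν) ≠ 0)
    (hgen : ∀ ν' : N, ∃ s c : C, s ≠ 0 ∧ s • ν' = c • ν) :
    ∃ e : (N →ₗ[C] L) →ₗ[C] F, Function.Injective e ∧ e δ = 1 ∧
      ∀ c : F, c ∈ LinearMap.range e ↔
        ∀ ν', c * algebraMap C F (ℓ (δ ν')) ∈ (algebraMap C F).range := by
  have hinj := IsFractionRing.injective C F
  set d : F := algebraMap C F (ℓ (δ ν)) with hd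
  have hd0 : d ≠ 0 := (map_ne_zero_iff _ hinj).2 hν
  obtain ⟨e, he⟩ : ∃ e : (N →ₗ[C] L) →ₗ[C] F, ∀ ψ, e ψ * d = algebraMap C F (ℓ (ψ ν)) :=
    -- The quotient of ψ by δ at ν. As N has rank one up to torsion, ψ is this multiple of δ
    -- everywhere, which is `key`.
    ⟨{  toFun := fun ψ => algebraMap C F (ℓ (ψ ν)) / d
        map_add' := fun ψ ψ' => by rw [LinearMap.add_apply, map_add, map_add, add_div]
        map_smul' := fun a ψ => by
          rw [LinearMap.smul_apply, map_smul, smul_eq_mul, map_mul, RingHom.id_apply,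
            Algebra.smul_def, mul_div_assoc] }, fun ψ => div_mul_cancel₀ _ hd0⟩
  have key (ψ : N →ₗ[C] L) (ν' : N) :
      algebraMap C F (ℓ (ψ ν')) = e ψ * algebraMap C F (ℓ (δ ν')) := by
    obtain ⟨s, c, hs, h⟩ := hgen ν'
    have h' (χ : N →ₗ[C] L) : algebraMap C F s * algebraMap C F (ℓ (χ ν')) =
        algebraMap C F c * algebraMap C F (ℓ (χ ν)) := by
      rw [← map_mul, ← map_mul, ← smul_eq_mul, ← smul_eq_mul, ← map_smul, ← map_smul, ← map_smul,
        ← map_smul, h]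
    have hs' : algebraMap C F s ≠ 0 := (map_ne_zero_iff _ hinj).2 hs
    refine mul_left_cancel₀ hs' ?_
    rw [h' ψ, ← he, mul_left_comm, mul_left_comm _ (e ψ), h' δ]
  refine ⟨e, ?_, mul_right_cancel₀ hd0 ((he _).trans (one_mul d).symm), fun c => ⟨?_, fun hc => ?_⟩⟩
  · refine (injective_iff_map_eq_zero e).2 fun ψ hψ => LinearMap.ext fun ν' => ?_
    have := key ψ ν'
    rw [hψ, zero_mul, map_eq_zero_iff _ hinj] at this
    rw [LinearMap.zero_apply, ← hℓ (ψ ν'), this, zero_smul]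
  · rintro ⟨ψ, rfl⟩ ν'
    rw [← key]
    exact ⟨_, rfl⟩
  · let g : N →ₗ[C] F := c • ((Algebra.linearMap C F) ∘ₗ ℓ ∘ₗ δ)
    have hg (ν') : g ν' ∈ LinearMap.range (Algebra.linearMap C F) := hc ν'
    let i := LinearEquiv.ofInjective (Algebra.linearMap C F) hinj
    let ψ : N →ₗ[C] L := (LinearMap.toSpanSingleton C _ l) ∘ₗ i.symm.toLinearMap ∘ₗ
      g.codRestrict _ hg
    refine ⟨ψ, ?_⟩
    have h1 : ℓ (ψ ν) = i.symm ⟨g ν, hg ν⟩ := by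
      change ℓ ((i.symm ⟨g ν, hg ν⟩ : C) • l) = _
      rw [map_smul, hl, smul_eq_mul, mul_one]
    have h2 : algebraMap C F (i.symm ⟨g ν, hg ν⟩) = g ν :=
      congrArg Subtype.val (i.apply_symm_apply ⟨g ν, hg ν⟩)
    refine mul_right_cancel₀ hd0 ?_
    rw [he, h1, h2]
    rfl

/-- The embedding of the canonical module in the fraction field, normalized by sending the canonical
element to `1`. -/
theorem exists_canonicalEmbedding [IsDomain C] (F : Type*) [Field F]
    [Algebra C F] [IsFractionRing C F] [Algebra B F] [IsScalarTower B C F]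
    [Algebra.FormallyEtale B F] :
    ∃ e : CanonicalModule P →ₗ[C] F, Function.Injective e ∧ e (canonicalElement P) = 1 ∧
      ∀ c : F, c ∈ LinearMap.range e ↔ ∀ f : Fin n → P.toExtension.ker,
        c * algebraMap C F (P.jacobianDet fun i => (f i).1) ∈ (algebraMap C F).range := by
  obtain ⟨ν, hν, hgen⟩ := exists_generic_generator P F
  set v := P.cotangentSpaceBasis
  obtain ⟨e, he, he1, hr⟩ := exists_homEmbedding F v.topPower (exteriorPower.ιMulti C n v)
    v.topPower_smul (by rw [v.topPower_ιMulti, v.det_self]) (canonicalElement P) ν hν hgen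
  refine ⟨e, he, he1, fun c => (hr c).trans ⟨fun h f => ?_, fun h ν' => ?_⟩⟩
  · rw [← topPower_canonicalElement_mk]
    exact h _
  · let g : ⋀[C]^n P.toExtension.Cotangent →ₗ[C] F :=
      c • ((Algebra.linearMap C F) ∘ₗ v.topPower ∘ₗ canonicalElement P)
    have hmem : ν' ∈ Submodule.span C (Set.range (exteriorPower.ιMulti C n
        (M := P.toExtension.Cotangent))) := by
      rw [exteriorPower.ιMulti_span]; trivial
    have hle : Submodule.span C (Set.range (exteriorPower.ιMulti C n
        (M := P.toExtension.Cotangent))) ≤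
        (LinearMap.range (Algebra.linearMap C F)).comap g := by
      rw [Submodule.span_le]
      rintro _ ⟨w, rfl⟩
      choose f hf using fun i => Algebra.Extension.Cotangent.mk_surjective (w i)
      obtain rfl : (fun i => Algebra.Extension.Cotangent.mk (f i)) = w := funext hf
      obtain ⟨a, ha⟩ := h f
      refine ⟨a, ?_⟩
      rw [← topPower_canonicalElement_mk] at ha
      exact ha
    exact hle hmem

end CanonicalEmbedding

/-! ### Linear forms as traces. -/

section Codifferent

variable {B A M F : Type*} [CommRing B] [CommRing A] [Field M] [Field F] [Algebra B A]
    [Algebra B M] [Algebra A F] [Algebra M F] [Algebra B F] [IsScalarTower B A F]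
    [IsScalarTower B M F]

theorem exists_linearForm_of_mem_codifferent (hinj : Function.Injective (algebraMap B M)) {x : F}
    (hx : x ∈ codifferent B A M F) : ∃ φ : A →ₗ[B] B, ∀ a,
      algebraMap B M (φ a) = Algebra.trace M F (x * algebraMap A F a) := by
  choose φ hφ using hx
  exact ⟨{  toFun := φ
            map_add' := fun a b => hinj (by rw [map_add, hφ, hφ, hφ, map_add, mul_add, map_add])
            map_smul' := fun b a => hinj (by
              have h : x * algebraMap A F (b • a) = algebraMap B M b • (x * algebraMap A F a) := by
                rw [algebraMap_smul M b, Algebra.smul_def, map_mul,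
                  ← IsScalarTower.algebraMap_apply B A F, Algebra.smul_def, mul_left_comm]
              rw [hφ, h, map_smul, ← hφ, smul_eq_mul, RingHom.id_apply, smul_eq_mul,
                map_mul]) }, hφ⟩

/-- F is the localization of A at S, so φ extends to an M-linear form on F, and nondegeneracy of the
trace form represents it by an element x. -/
theorem exists_mem_codifferent_of_linearForm (S : Submonoid B) [IsLocalization S M]
    [IsLocalizedModule S (IsScalarTower.toAlgHom B A F).toLinearMap] [FiniteDimensional M F] [Algebra.IsSeparable M F]
    (φ : A →ₗ[B] B) : ∃ x ∈ codifferent B A M F, ∀ a,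
      algebraMap B M (φ a) = Algebra.trace M F (x * algebraMap A F a) := by
  let ψ : F →ₗ[M] M := (IsLocalizedModule.map S (IsScalarTower.toAlgHom B A F).toLinearMap
    (Algebra.linearMap B M) φ).extendScalarsOfIsLocalization S M
  have hψ (a : A) : ψ (algebraMap A F a) = algebraMap B M (φ a) :=
    IsLocalizedModule.map_apply S (IsScalarTower.toAlgHom B A F).toLinearMap
      (Algebra.linearMap B M) φ a
  let x := (LinearMap.BilinForm.toDual (Algebra.traceForm M F)
    (traceForm_nondegenerate M F)).symm ψ
  have hx (y : F) : Algebra.trace M F (x * y) = ψ y :=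
    LinearMap.BilinForm.apply_toDual_symm_apply (B := Algebra.traceForm M F)
      (hB := traceForm_nondegenerate M F) ψ y
  refine ⟨x, fun a => ⟨φ a, ?_⟩, fun a => ?_⟩ <;> rw [hx, hψ]

theorem eq_of_trace_mul_algebraMap_eq (S : Submonoid B) [IsLocalization S M]
    [IsLocalizedModule S (IsScalarTower.toAlgHom B A F).toLinearMap] [FiniteDimensional M F] [Algebra.IsSeparable M F]
    {x y : F} (h : ∀ a : A, Algebra.trace M F (x * algebraMap A F a) =
      Algebra.trace M F (y * algebraMap A F a)) : x = y := by
  have hnd := traceForm_nondegenerate M F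
  rw [← sub_eq_zero]
  refine hnd.1 _ fun z => ?_
  obtain ⟨⟨a, s⟩, hz⟩ :=
    IsLocalizedModule.surj S (IsScalarTower.toAlgHom B A F).toLinearMap z
  have hs : algebraMap B M s ≠ 0 := (IsLocalization.map_units M s).ne_zero
  refine (mul_eq_zero.1 (?_ : algebraMap B M s * _ = 0)).resolve_left hs
  rw [← smul_eq_mul, ← map_smul, algebraMap_smul]
  change Algebra.traceForm M F (x - y) (s • z) = 0
  rw [hz]
  change Algebra.trace M F ((x - y) * algebraMap A F a) = 0
  rw [sub_mul, map_sub, h, sub_self]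

theorem exists_codifferentEquiv (S : Submonoid B) [IsLocalization S M]
    [IsLocalizedModule S (IsScalarTower.toAlgHom B A F).toLinearMap] [FiniteDimensional M F] [Algebra.IsSeparable M F]
    (hinj : Function.Injective (algebraMap B M)) :
    ∃ c : codifferent B A M F ≃ₗ[A] DualizingModule B A,
      ∀ (x : codifferent B A M F) (a : A),
        algebraMap B M (c x a) = Algebra.trace M F ((x : F) * algebraMap A F a) := by
  choose φ hφ using fun x : codifferent B A M F => exists_linearForm_of_mem_codifferent hinj x.2
  let c : codifferent B A M F →ₗ[A] DualizingModule B A :=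
    { toFun := fun x => φ x
      map_add' := fun x y => LinearMap.ext fun a => hinj (by
        refine (hφ _ a).trans (Eq.trans ?_ (map_add (algebraMap B M) (φ x a) (φ y a)).symm)
        rw [hφ, hφ, Submodule.coe_add, add_mul, map_add])
      map_smul' := fun r x => LinearMap.ext fun a => hinj (by
        refine (hφ _ a).trans (Eq.trans ?_ (hφ x (r * a)).symm)
        rw [Submodule.coe_smul, Algebra.smul_def, map_mul (algebraMap A F)]
        congr 1
        ring) }
  refine ⟨LinearEquiv.ofBijective c ⟨fun x y hxy => ?_, fun ψ => ?_⟩, hφ⟩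
  · refine Subtype.ext (eq_of_trace_mul_algebraMap_eq (A := A) (M := M) S fun a => ?_)
    rw [← hφ, ← hφ]
    exact congrArg _ (DFunLike.congr_fun hxy a)
  · obtain ⟨x, hx, h⟩ := exists_mem_codifferent_of_linearForm (M := M) (F := F) S ψ
    refine ⟨⟨x, hx⟩, LinearMap.ext fun a => hinj ?_⟩
    exact (hφ _ a).trans (h a).symm

end Codifferent

/-! ### Dual bases up to a denominator. -/

section LocallyFree

/-- A finite module which is free after localization has, up to a denominator, a dual basis. -/
theorem exists_dual_family_of_free_localization {B A : Type*} [CommRing B] [AddCommGroup A]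
    [Module B A] [Module.FinitePresentation B A] (S : Submonoid B)
    [Module.Free (Localization S) (LocalizedModule S A)] :
    ∃ s ∈ S, ∃ (k : ℕ) (a : Fin k → A) (φ : Fin k → A →ₗ[B] B),
      ∀ x, s • x = ∑ i, φ i x • a i := by
  classical
  let mk := LocalizedModule.mkLinearMap S A
  let b := (Module.Free.chooseBasis (Localization S) (LocalizedModule S A)).reindex
    (Fintype.equivFin _)
  choose p hp using fun i => IsLocalizedModule.surj S mk (b i)
  let coord (i) : A →ₗ[B] Localization S := ((b.coord i).restrictScalars B) ∘ₗ mk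
  choose φ σ hφ using fun i =>
    Module.FinitePresentation.exists_lift_of_isLocalizedModule S
      (Algebra.linearMap B (Localization S)) (coord i)
  let e (i) : S := σ i * (p i).2
  -- D is multiplication by a common denominator, D' the expansion in numerators of the basis with
  -- lifted coordinate forms. They agree after localization, hence after multiplication by some t in
  -- S.
  let D : A →ₗ[B] A := ((∏ i, e i : S) : B) • LinearMap.id
  let D' : A →ₗ[B] A := ∑ i, ((∏ j ∈ Finset.univ.erase i, e j : S) : B) •
    (LinearMap.toSpanSingleton B A (p i).1 ∘ₗ φ i)
  have hD : mk ∘ₗ D = mk ∘ₗ D' := by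
    refine LinearMap.ext fun x => ?_
    have h1 : mk x = ∑ i, coord i x • b i := (b.sum_repr (mk x)).symm
    simp only [D, D', LinearMap.comp_apply, LinearMap.smul_apply, LinearMap.id_apply,
      LinearMap.sum_apply, map_sum, map_smul, LinearMap.toSpanSingleton_apply]
    rw [h1, Finset.smul_sum]
    refine Finset.sum_congr rfl fun i _ => ?_
    have h2 : algebraMap B (Localization S) (φ i x) = (σ i : B) • coord i x :=
      DFunLike.congr_fun (hφ i) x
    have h3 : ((∏ i, e i : S) : B) =
        ((∏ j ∈ Finset.univ.erase i, e j : S) : B) * ((σ i : B) * ((p i).2 : B)) := by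
      rw [← Finset.prod_erase_mul _ _ (Finset.mem_univ i)]; rfl
    have h4 : mk (p i).1 = ((p i).2 : B) • b i := (hp i).symm
    rw [h3, h4, mul_smul]
    congr 1
    rw [← algebraMap_smul (Localization S) (φ i x), h2, mul_smul, smul_comm _ (coord i x),
      smul_assoc, smul_comm (coord i x)]
  obtain ⟨t, ht⟩ := Module.Finite.exists_smul_of_comp_eq_of_isLocalizedModule S mk D D' hD
  refine ⟨t * (∏ i, e i : S), (t * ∏ i, e i).2, _, fun i => (p i).1,
    fun i => (t * (∏ j ∈ Finset.univ.erase i, e j : S) : B) • φ i, fun x => ?_⟩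
  have := DFunLike.congr_fun ht x
  simp only [D, D', LinearMap.smul_apply, LinearMap.id_apply, Submonoid.smul_def,
      LinearMap.sum_apply, LinearMap.comp_apply, LinearMap.toSpanSingleton_apply] at this
  rw [mul_smul, this, Finset.smul_sum]
  refine Finset.sum_congr rfl fun i _ => ?_
  rw [LinearMap.smul_apply, smul_assoc, mul_smul]

/-- If `A` is, up to a denominator `s`, a direct summand of a finite free module, then an element of
`κ ⊗ A` killed by all linear forms on `A` vanishes as soon as `s` is invertible in `κ`. -/
theorem eq_zero_of_forall_evalRight_eq_zero {B A κ : Type*} [CommRing B] [AddCommGroup A]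
    [Module B A] [CommRing κ] [Algebra B κ] {ι : Type*} [Fintype ι] (s : B)
    (hs : IsUnit (algebraMap B κ s)) (a : ι → A) (φ : ι → A →ₗ[B] B)
    (h : ∀ x, s • x = ∑ i, φ i x • a i) (z : κ ⊗[B] A) (hz : ∀ i, evalRight κ (φ i) z = 0) :
    z = 0 := by
  have h1 (z : κ ⊗[B] A) : algebraMap B κ s • z = ∑ i, evalRight κ (φ i) z ⊗ₜ a i := by
    induction z with
    | zero => simp
    | add y z hy hz => simp only [smul_add, hy, hz, map_add, TensorProduct.add_tmul,
        Finset.sum_add_distrib]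
    | tmul c x =>
      rw [algebraMap_smul, TensorProduct.smul_tmul', TensorProduct.smul_tmul, h,
        TensorProduct.tmul_sum]
      refine Finset.sum_congr rfl fun i _ => ?_
      rw [evalRight_tmul, TensorProduct.smul_tmul]
  have h2 := h1 z
  simp only [hz, TensorProduct.zero_tmul, Finset.sum_const_zero] at h2
  exact (hs.smul_eq_zero).1 h2

end LocallyFree

/-! ### Jacobian determinants against the codifferent. -/

section LocalGenerator

variable {B A M F C : Type*} [CommRing B] [CommRing A] [Field M] [Field F] [CommRing C]
    [Algebra B A] [Algebra B M] [Algebra A F] [Algebra M F] [Algebra B F]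
    [IsScalarTower B M F] [Algebra A C] [Algebra B C] [IsScalarTower B A C] [Algebra C F]
    [IsScalarTower A C F] [IsScalarTower B C F]

/-- Contraction of a diagonal element of `C ⊗ C` by the linear form `Tr (x ·)`. -/
theorem algebraMap_evalRight_of_diagonal [IsDomain C] [IsFractionRing C F] [FiniteDimensional M F]
    (Δ : C ⊗[B] C) (hΔ : ∀ a : C, (1 ⊗ₜ a) * Δ = (a ⊗ₜ 1) * Δ) (u : A) (z : C ⊗[B] A)
    (hz : Algebra.TensorProduct.map (AlgHom.id B C) (IsScalarTower.toAlgHom B A C) z =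
      (1 ⊗ₜ algebraMap A C u) * Δ) (x : F) (φ : A →ₗ[B] B)
    (hφ : ∀ a, algebraMap B M (φ a) = Algebra.trace M F (x * algebraMap A F a)) :
    algebraMap C F (evalRight C φ z) =
      algebraMap C F (Algebra.TensorProduct.lmul' B (S := C) Δ) * (algebraMap A F u * x) := by
  let ι := IsScalarTower.toAlgHom B C F
  let Φ : C ⊗[B] C →ₐ[B] F ⊗[M] F :=
    (Algebra.TensorProduct.mapOfCompatibleSMul M B B F F).comp (Algebra.TensorProduct.map ι ι)
  have hΦ (a b : C) : Φ (a ⊗ₜ b) = algebraMap C F a ⊗ₜ algebraMap C F b := rfl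
  have hC (a : C) : ((1 : F) ⊗ₜ[M] algebraMap C F a) * Φ Δ = (algebraMap C F a ⊗ₜ 1) * Φ Δ := by
    have := congrArg Φ (hΔ a)
    rw [map_mul, map_mul, hΦ, hΦ, map_one] at this
    exact this
  -- Elements of F are fractions of C, and the diagonal relation passes to inverses of denominators;
  -- so the trace formula applies over F.
  have hF (a : F) : ((1 : F) ⊗ₜ[M] a) * Φ Δ = (a ⊗ₜ 1) * Φ Δ := by
    obtain ⟨a, b, hb, rfl⟩ := IsFractionRing.div_surjective (A := C) a
    have hb0 : algebraMap C F b ≠ 0 :=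
      IsFractionRing.to_map_ne_zero_of_mem_nonZeroDivisors hb
    have h1 : (1 : F) ⊗ₜ[M] (algebraMap C F a / algebraMap C F b) =
        (1 ⊗ₜ (algebraMap C F b)⁻¹) * (1 ⊗ₜ algebraMap C F a) := by
      simp [div_eq_mul_inv, mul_comm]
    have h2 : (algebraMap C F a / algebraMap C F b) ⊗ₜ[M] (1 : F) =
        ((algebraMap C F b)⁻¹ ⊗ₜ 1) * (algebraMap C F a ⊗ₜ 1) := by
      simp [div_eq_mul_inv, mul_comm]
    have h3 : ((1 : F) ⊗ₜ[M] (algebraMap C F b)⁻¹) * Φ Δ =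
        ((algebraMap C F b)⁻¹ ⊗ₜ 1) * Φ Δ := by
      have h4 : ((algebraMap C F b)⁻¹ ⊗ₜ[M] (algebraMap C F b)⁻¹) *
          (((1 : F) ⊗ₜ[M] algebraMap C F b) * Φ Δ) =
          ((algebraMap C F b)⁻¹ ⊗ₜ[M] (algebraMap C F b)⁻¹) *
          ((algebraMap C F b ⊗ₜ 1) * Φ Δ) := by rw [hC]
      rw [← mul_assoc, ← mul_assoc] at h4
      simpa [hb0] using h4.symm
    rw [h1, h2, mul_assoc, hC, mul_left_comm, h3]
    ring
  have hμ (w : C ⊗[B] C) : Algebra.TensorProduct.lmul' M (S := F) (Φ w) =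
      algebraMap C F (Algebra.TensorProduct.lmul' B (S := C) w) := by
    induction w with
    | zero => simp
    | add a b ha hb => rw [map_add, map_add, ha, hb, map_add, map_add]
    | tmul a b => rw [hΦ]; simp
  have htr (w : C ⊗[B] A) : algebraMap C F (evalRight C φ w) =
      evalRight F (Algebra.trace M F) ((1 ⊗ₜ x) * Φ
        (Algebra.TensorProduct.map (AlgHom.id B C) (IsScalarTower.toAlgHom B A C) w)) := by
    induction w with
    | zero => simp
    | add a b ha hb => simp only [map_add, mul_add, ha, hb]
    | tmul c a =>
      rw [evalRight_tmul, Algebra.TensorProduct.map_tmul, hΦ, Algebra.TensorProduct.tmul_mul_tmul,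
        evalRight_tmul, Algebra.smul_def, map_mul, Algebra.smul_def, one_mul]
      rw [← IsScalarTower.algebraMap_apply B C F, IsScalarTower.algebraMap_apply B M F, hφ]
      simp [← IsScalarTower.algebraMap_apply A C F]
  rw [htr, hz, map_mul Φ, hΦ, ← mul_assoc, Algebra.TensorProduct.tmul_mul_tmul]
  rw [evalRight_trace_of_diagonal _ fun a => by rw [mul_left_comm, hF, mul_left_comm]]
  rw [map_mul, hμ, ← IsScalarTower.algebraMap_apply A C F]
  simp
  ring

/-- A linear form φ is defined on A only. Clearing the powers of g in the right factor moves an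
element of C ⊗ C into C ⊗ A, where φ can be contracted. -/
theorem exists_map_eq_mul (g : A) [IsLocalization.Away g C] (w : C ⊗[B] C) :
    ∃ (k : ℕ) (z : C ⊗[B] A),
      Algebra.TensorProduct.map (AlgHom.id B C) (IsScalarTower.toAlgHom B A C) z =
        (1 ⊗ₜ algebraMap A C (g ^ k)) * w := by
  induction w with
  | zero => exact ⟨0, 0, by simp⟩
  | tmul c d =>
    obtain ⟨⟨a, _, k, rfl⟩, h⟩ := IsLocalization.surj (Submonoid.powers g) d
    refine ⟨k, c ⊗ₜ a, ?_⟩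
    rw [Algebra.TensorProduct.map_tmul, Algebra.TensorProduct.tmul_mul_tmul, one_mul, mul_comm _ d,
      h]
    rfl
  | add v w hv hw =>
    obtain ⟨k, y, hy⟩ := hv
    obtain ⟨l, z, hz⟩ := hw
    refine ⟨k + l, (1 ⊗ₜ (g ^ l)) * y + (1 ⊗ₜ (g ^ k)) * z, ?_⟩
    rw [map_add, map_mul, map_mul, hy, hz, Algebra.TensorProduct.map_tmul,
      Algebra.TensorProduct.map_tmul, mul_add, pow_add, map_mul, ← mul_assoc, ← mul_assoc]
    simp [mul_comm]

variable [IsScalarTower B A F]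

/-- The Jacobian determinants multiply the codifferent into `C`. -/
theorem jacobianDet_mul_mem [IsDomain C] [IsFractionRing C F] [FiniteDimensional M F]
    (hinj : Function.Injective (algebraMap B M)) (g : A) [IsLocalization.Away g C] {m : ℕ}
    (Q : Algebra.Generators B C (Fin m)) (f : Fin m → Q.toExtension.ker) {x : F}
    (hx : x ∈ codifferent B A M F) :
    x * algebraMap C F (Q.jacobianDet fun i => (f i).1) ∈ (algebraMap C F).range := by
  have hf (i) : MvPolynomial.aeval Q.val (f i).1 = 0 := Q.aeval_val_eq_zero (f i).2
  obtain ⟨b, hb, hb'⟩ := MvPolynomial.exists_taylorAt_eq_mulVec Q.val (fun i => (f i).1) hf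
  have hdiag := diagonalEval_det_mul Q.val Q.aeval_val_surjective _ hf b hb
  obtain ⟨k, z, hz⟩ := exists_map_eq_mul g (diagonalEval (B := B) Q.val Q.val b.det)
  obtain ⟨φ, hφ⟩ := exists_linearForm_of_mem_codifferent hinj hx
  -- The contraction belongs to C and equals J·(g^k x), with g invertible in C.
  have h := algebraMap_evalRight_of_diagonal _ hdiag _ z hz x φ hφ
  have hJ : MvPolynomial.constantCoeff b.det = Q.jacobianDet fun i => (f i).1 := by
    rw [RingHom.map_det]
    refine congrArg Matrix.det ?_
    ext i j
    exact hb' i j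
  rw [lmul'_diagonalEval, hJ, IsScalarTower.algebraMap_apply A C F] at h
  obtain ⟨v, hv⟩ := (IsLocalization.Away.algebraMap_pow_isUnit (S := C) g k).exists_left_inv
  rw [← map_pow] at hv
  refine ⟨v * evalRight C φ z, ?_⟩
  have hv' : algebraMap C F v * algebraMap C F (algebraMap A C (g ^ k)) = 1 := by
    rw [← map_mul, hv, map_one]
  rw [map_mul, h]
  linear_combination (x * algebraMap C F (Q.jacobianDet fun i => (f i).1)) * hv'

end LocalGenerator

section LocalGenerator

variable {B A M F C : Type*} [CommRing B] [CommRing A] [Field M] [Field F] [CommRing C]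
    [Algebra B A] [Algebra B M] [Algebra A F] [Algebra M F] [Algebra B F]
    [IsScalarTower B M F] [Algebra A C] [Algebra B C] [IsScalarTower B A C] [Algebra C F]
    [IsScalarTower A C F] [IsScalarTower B C F] [IsScalarTower B A F]

/-- C itself need not be finite over B, but it is quasi-finite, being a localization of a finite
algebra. -/
theorem finite_tensor_of_isLocalization (κ : Type*) [Field κ] [Algebra B κ] [Module.Finite B A]
    (g : A) [IsLocalization.Away g C] : Module.Finite κ (κ ⊗[B] C) := by
  have : Algebra.QuasiFinite B C := Algebra.QuasiFinite.of_isLocalization (S := A) (.powers g)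
  exact Module.Finite.of_quasiFinite

/-- For a presentation of `C = A_h` by as many relations as variables, with `A` locally free over `B`
at the point `q`, the Jacobian determinant generates the inverse of the codifferent at `q`. -/
theorem exists_mem_codifferent_jacobianDet_mul_eq [IsDomain C] [IsFractionRing C F]
    [FiniteDimensional M F] [Algebra.IsSeparable M F] (S : Submonoid B) [IsLocalization S M]
    [IsLocalizedModule S (IsScalarTower.toAlgHom B A F).toLinearMap] [Module.Finite B A]
    (κ : Type*) [Field κ] [Algebra A κ] [Algebra B κ] [Algebra C κ] [IsScalarTower B A κ]
    [IsScalarTower A C κ] [IsScalarTower B C κ] (h : A) [IsLocalization.Away h C]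
    (s : B) (hs : algebraMap B κ s ≠ 0) {r : ℕ} (a : Fin r → A) (φ : Fin r → A →ₗ[B] B)
    (hφ : ∀ x, s • x = ∑ i, φ i x • a i) {n : ℕ}
    (P : Algebra.Generators B C (Fin n)) (f : Fin n → MvPolynomial (Fin n) B)
    (hf : P.ker = Ideal.span (Set.range f)) :
    ∃ x ∈ codifferent B A M F, ∃ a' : A, algebraMap A κ a' ≠ 0 ∧
      algebraMap C F (P.jacobianDet f) * x = algebraMap A F a' := by
  -- If J·x vanishes at the point whenever it lies in A, then all forms φ i contract z to 0 in κ. By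
  -- the dual family z vanishes in κ ⊗ A, hence so does the determinant in κ ⊗ C, contradicting its
  -- nonvanishing in the fibre.
  by_contra! hcon
  have hfi (i) : MvPolynomial.aeval P.val (f i) = 0 :=
    P.aeval_val_eq_zero (hf ▸ Ideal.subset_span ⟨i, rfl⟩)
  obtain ⟨b, hb, hb'⟩ := MvPolynomial.exists_taylorAt_eq_mulVec P.val f hfi
  have hdiag := diagonalEval_det_mul P.val P.aeval_val_surjective _ hfi b hb
  obtain ⟨k, z, hz⟩ := exists_map_eq_mul h (diagonalEval (B := B) P.val P.val b.det)
  have hJ : MvPolynomial.constantCoeff b.det = P.jacobianDet f := by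
    rw [RingHom.map_det]
    refine congrArg Matrix.det ?_
    ext i j
    exact hb' i j
  have hunit (l : ℕ) : IsUnit (algebraMap A C (h ^ l)) := by
    rw [map_pow]; exact IsLocalization.Away.algebraMap_pow_isUnit h l
  have h1 (i) : algebraMap C κ (evalRight C (φ i) z) = 0 := by
    obtain ⟨x, hx, hφx⟩ := exists_mem_codifferent_of_linearForm (M := M) (F := F) S (φ i)
    have h2 := algebraMap_evalRight_of_diagonal _ hdiag _ z hz x (φ i) hφx
    rw [lmul'_diagonalEval, hJ] at h2
    obtain ⟨⟨a', _, l, rfl⟩, hl⟩ :=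
      IsLocalization.surj (Submonoid.powers h) (evalRight C (φ i) z)
    have h3 := mt (hcon ((h ^ l * h ^ k) • x) (Submodule.smul_mem _ _ hx) a')
    rw [not_not, not_not] at h3
    have h4 : algebraMap A κ a' = 0 := by
      refine h3 ?_
      have h5 := congrArg (algebraMap C F) hl
      rw [map_mul, h2, ← IsScalarTower.algebraMap_apply, ← IsScalarTower.algebraMap_apply] at h5
      rw [← h5, Algebra.smul_def, map_mul]
      ring
    have h6 := congrArg (algebraMap C κ) hl
    rw [map_mul, ← IsScalarTower.algebraMap_apply A C κ a', h4] at h6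
    exact (mul_eq_zero.1 h6).resolve_right ((hunit l).map (algebraMap C κ)).ne_zero
  let ρ := IsScalarTower.toAlgHom B C κ
  have hev (i) (w : C ⊗[B] A) : evalRight κ (φ i)
      (Algebra.TensorProduct.map ρ (AlgHom.id B A) w) = algebraMap C κ (evalRight C (φ i) w) := by
    induction w with
    | zero => simp
    | add y w hy hw => simp only [map_add, hy, hw]
    | tmul c x =>
      rw [Algebra.TensorProduct.map_tmul, evalRight_tmul, evalRight_tmul, Algebra.smul_def,
        Algebra.smul_def, map_mul, ← IsScalarTower.algebraMap_apply]
      rfl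
  have h7 : Algebra.TensorProduct.map ρ (AlgHom.id B A) z = 0 :=
    eq_zero_of_forall_evalRight_eq_zero s hs.isUnit a φ hφ _ fun i => by rw [hev, h1]
  have hcomm (w : C ⊗[B] A) : Algebra.TensorProduct.map ρ (AlgHom.id B C)
      (Algebra.TensorProduct.map (AlgHom.id B C) (IsScalarTower.toAlgHom B A C) w) =
      Algebra.TensorProduct.map (AlgHom.id B κ) (IsScalarTower.toAlgHom B A C)
        (Algebra.TensorProduct.map ρ (AlgHom.id B A) w) := by
    induction w with
    | zero => simp
    | add y w hy hw => simp only [map_add, hy, hw]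
    | tmul c x => rfl
  have h8 := hcomm z
  rw [h7, map_zero, hz, map_mul] at h8
  have h9 : IsUnit (Algebra.TensorProduct.map ρ (AlgHom.id B C)
      ((1 : C) ⊗ₜ[B] algebraMap A C (h ^ k))) :=
    ((hunit k).map (Algebra.TensorProduct.includeRight : C →ₐ[B] C ⊗[B] C)).map _
  have := finite_tensor_of_isLocalization (B := B) (A := A) (C := C) κ h
  exact map_diagonalEval_det_ne_zero (κ := κ) P.val P.aeval_val_surjective f
    (P.ker_eq_ker_aeval_val.symm.trans hf) b hb (h9.mul_right_eq_zero.1 h8)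

end LocalGenerator

/-! ### Jacobian determinants and the Fitting ideal of the differentials. -/

section Fitting

open KaehlerDifferential

variable {B C L F : Type*} [CommRing B] [CommRing C] [CommRing L] [Algebra B C] [Algebra B L]
  [Algebra C L] [IsScalarTower B C L] {m : ℕ} (Q : Algebra.Generators B C (Fin m))

/-- The differentials of the generators of `C`, in a localization `L` of `C`. -/
def Algebra.Generators.differential (L : Type*) [CommRing L] [Algebra B L]
    [Algebra C L] [IsScalarTower B C L] (j : Fin m) : Ω[L⁄B] :=
  KaehlerDifferential.map B B C L (D B C (Q.val j))

theorem span_differential (S : Submonoid C) [IsLocalization S L] :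
    Submodule.span L (Set.range (Q.differential L)) = ⊤ := by
  have h1 : Submodule.span C (Set.range fun j => D B C (Q.val j)) = ⊤ := by
    have h := congrArg (Submodule.map Q.toExtension.toKaehler) Q.cotangentSpaceBasis.span_eq
    rw [Submodule.map_span, ← Set.range_comp, Submodule.map_top,
      LinearMap.range_eq_top.2 Q.toExtension.toKaehler_surjective] at h
    rw [← h]
    congr 2
    ext1 j
    exact (Q.toKaehler_cotangentSpaceBasis j).symm
  have := span_eq_top_of_isLocalizedModule L S (KaehlerDifferential.map B B C L) h1
  rw [← Set.range_comp] at this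
  exact this

theorem toKaehler_eq_sum (y : Q.toExtension.CotangentSpace) :
    Q.toExtension.toKaehler y = ∑ j, Q.cotangentSpaceBasis.repr y j • D B C (Q.val j) := by
  conv_lhs => rw [← Q.cotangentSpaceBasis.sum_repr y, map_sum]
  refine Finset.sum_congr rfl fun j _ => ?_
  rw [map_smul, Q.toKaehler_cotangentSpaceBasis]

theorem repr_cotangentComplex_mk (f : Q.toExtension.ker) (j : Fin m) :
    Q.cotangentSpaceBasis.repr (Q.toExtension.cotangentComplex (Algebra.Extension.Cotangent.mk f)) j =
      MvPolynomial.aeval Q.val (MvPolynomial.pderiv j f.1) := by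
  rw [Algebra.Extension.cotangentComplex_mk]
  exact Q.cotangentSpaceBasis_repr_one_tmul _ _

theorem sum_pderiv_smul_differential (f : Q.toExtension.ker) :
    ∑ j, algebraMap C L (MvPolynomial.aeval Q.val (MvPolynomial.pderiv j f.1)) •
      Q.differential L j = 0 := by
  have h1 := (Q.toExtension.exact_cotangentComplex_toKaehler _).2
    ⟨Algebra.Extension.Cotangent.mk f, rfl⟩
  rw [toKaehler_eq_sum] at h1
  have h2 := congrArg (KaehlerDifferential.map B B C L) h1
  rw [map_zero, map_sum] at h2
  rw [← h2]
  refine Finset.sum_congr rfl fun j _ => ?_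
  rw [map_smul, repr_cotangentComplex_mk, algebraMap_smul]
  rfl

/-- By exactness of I/I² → C ⊗ Ω → Ω, a relation between the differentials of the generators is,
after clearing denominators, the gradient of an element of I. -/
theorem exists_ker_of_sum_smul_differential (S : Submonoid C) [IsLocalization S L] (v : Fin m → L)
    (hv : ∑ j, v j • Q.differential L j = 0) : ∃ s ∈ S, ∃ f : Q.toExtension.ker, ∀ j,
      algebraMap C L (MvPolynomial.aeval Q.val (MvPolynomial.pderiv j f.1)) =
        algebraMap C L s * v j := by
  obtain ⟨s, hs⟩ := IsLocalization.exist_integer_multiples_of_finite S v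
  choose w hw using hs
  have h1 : KaehlerDifferential.map B B C L (∑ j, w j • D B C (Q.val j)) = 0 := by
    rw [map_sum, ← smul_zero (s : C), ← hv, Finset.smul_sum]
    refine Finset.sum_congr rfl fun j _ => ?_
    rw [map_smul, ← smul_assoc, ← hw, algebraMap_smul]
    rfl
  obtain ⟨s', hs'⟩ := (IsLocalizedModule.eq_zero_iff S (KaehlerDifferential.map B B C L)).1 h1
  let y : Q.toExtension.CotangentSpace := ∑ j, ((s' : C) * w j) • Q.cotangentSpaceBasis j
  have hy : Q.toExtension.toKaehler y = 0 := by
    rw [← hs', map_sum, Submonoid.smul_def, Finset.smul_sum]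
    refine Finset.sum_congr rfl fun j _ => ?_
    rw [map_smul, Q.toKaehler_cotangentSpaceBasis, mul_smul]
  obtain ⟨x, hx⟩ := (Q.toExtension.exact_cotangentComplex_toKaehler _).1 hy
  obtain ⟨f, rfl⟩ := Algebra.Extension.Cotangent.mk_surjective x
  refine ⟨s' * s, (s' * s).2, f, fun j => ?_⟩
  rw [← repr_cotangentComplex_mk, hx, Module.Basis.repr_sum_self, map_mul, map_mul, hw,
    Algebra.smul_def, mul_assoc]

/-- If `c` multiplies the Jacobian determinants of one presentation into `C`, then it multiplies those
of any other presentation into every common localization `L`. -/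
theorem mul_jacobianDet_mem_of_forall {C' : Type*} [CommRing C'] [Field F] [Algebra B C']
    [Algebra C' L] [Algebra L F] [Algebra C F] [Algebra C' F] [IsScalarTower B C' L]
    [IsScalarTower C L F] [IsScalarTower C' L F] (S : Submonoid C) [IsLocalization S L]
    (S' : Submonoid C') [IsLocalization S' L] {n : ℕ}
    (P : Algebra.Generators B C' (Fin n)) (c : F)
    (hc : ∀ f : Fin m → Q.toExtension.ker,
      c * algebraMap C F (Q.jacobianDet fun i => (f i).1) ∈ (algebraMap C F).range)
    (f : Fin n → MvPolynomial (Fin n) B) (hf : ∀ i, f i ∈ P.ker) :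
    c * algebraMap C' F (P.jacobianDet f) ∈ (algebraMap L F).range := by
  -- The elements of L which c multiplies into L. The Fitting ideal comparison is run with this
  -- ideal as target.
  let 𝔟 : Ideal L := (LinearMap.range (Algebra.linearMap L F)).comap (c • Algebra.linearMap L F)
  have hdet : algebraMap C' L (P.jacobianDet f) = Matrix.det
      (Matrix.of fun i j => algebraMap C' L
        (MvPolynomial.aeval P.val (MvPolynomial.pderiv j (f i)))) := by
    refine (RingHom.map_det _ _).trans (congrArg Matrix.det ?_)
    ext i j; rfl
  suffices h : algebraMap C' L (P.jacobianDet f) ∈ 𝔟 by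
    rw [IsScalarTower.algebraMap_apply C' L F]
    exact h
  rw [hdet]
  refine Matrix.det_mem_of_relations (Q.differential L) (P.differential L)
    (fun j => by rw [span_differential P S']; trivial)
    (fun j => by rw [span_differential Q S]; trivial) 𝔟 (fun v hv => ?_) _
    (fun i => sum_pderiv_smul_differential P ⟨f i, hf i⟩)
  choose s hs g hg using fun i => exists_ker_of_sum_smul_differential Q S (v i) (hv i)
  have h1 : algebraMap C L (Q.jacobianDet fun i => (g i).1) =
      algebraMap C L (∏ i, s i) * v.det := by
    rw [map_prod, ← Matrix.det_mul_column]
    refine (RingHom.map_det _ _).trans (congrArg Matrix.det ?_)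
    ext i j
    exact hg i j
  obtain ⟨a, ha⟩ := hc g
  obtain ⟨u, hu⟩ := (IsLocalization.map_units L (⟨∏ i, s i, prod_mem fun i _ => hs i⟩ : S)).exists_left_inv
  refine ⟨u * algebraMap C L a, ?_⟩
  change algebraMap L F _ = c * algebraMap L F v.det
  have h2 : v.det = u * algebraMap C L (Q.jacobianDet fun i => (g i).1) := by
    rw [h1, ← mul_assoc, hu, one_mul]
  rw [h2, map_mul, map_mul, ← IsScalarTower.algebraMap_apply, ← IsScalarTower.algebraMap_apply, ha]
  ring

end Fitting

/-! ### The number of relations in a regular presentation. -/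

section Presentation

/-- A regular sequence of relations presenting a domain which contains `B` is at most as long as the
number of variables. -/
theorem length_le_of_isRegular {B C : Type*} [CommRing B] [IsDomain B] [IsNoetherianRing B]
    [CommRing C] [IsDomain C] [Algebra B C] [FaithfulSMul B C] {n : ℕ}
    (Q : Algebra.Generators B C (Fin n)) (fs : List (MvPolynomial (Fin n) B))
    (hreg : RingTheory.Sequence.IsRegular (MvPolynomial (Fin n) B) fs)
    (hker : Q.ker = Ideal.ofList fs) : fs.length ≤ n := by
  let I : Ideal (MvPolynomial (Fin n) B) := Q.ker
  have hI : I.IsPrime := by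
    change Ideal.IsPrime Q.ker
    rw [Q.ker_eq_ker_aeval_val]
    exact RingHom.ker_isPrime _
  have hmem : ∀ r ∈ fs, r ∈ I := fun r hr => by
    change r ∈ Q.ker
    rw [hker]; exact Ideal.subset_span hr
  have h1 := hreg.toIsWeaklyRegular.isRegular_of_isLocalization_of_mem (Localization.AtPrime I) I hmem
  have h2 := ringKrullDim_add_length_eq_ringKrullDim_of_isRegular _ h1
  rw [List.length_map, IsLocalization.AtPrime.ringKrullDim_eq_height I (Localization.AtPrime I)] at h2
  -- The regular sequence has length at most the height of I. As B embeds in C, I meets B in 0, so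
  -- the height is unchanged over K, where the polynomial ring has dimension n whatever the
  -- dimension of B.
  let K := FractionRing B
  let _ : Algebra (MvPolynomial (Fin n) B) (MvPolynomial (Fin n) K) :=
    MvPolynomial.algebraMvPolynomial
  have hdisj : Disjoint (((nonZeroDivisors B).map (MvPolynomial.C (σ := Fin n)) :
      Submonoid (MvPolynomial (Fin n) B)) : Set (MvPolynomial (Fin n) B)) (I : Set _) := by
    rw [Set.disjoint_left]
    rintro _ ⟨b, hb, rfl⟩ hbI
    have : MvPolynomial.aeval Q.val (MvPolynomial.C b) = 0 := Q.aeval_val_eq_zero hbI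
    rw [MvPolynomial.aeval_C] at this
    exact nonZeroDivisors.ne_zero hb
      ((map_eq_zero_iff _ (FaithfulSMul.algebraMap_injective B C)).1 this)
  have h3 : (I.map (algebraMap _ (MvPolynomial (Fin n) K))).height = I.height :=
    IsLocalization.height_map_of_disjoint
      ((nonZeroDivisors B).map (MvPolynomial.C (σ := Fin n))) I hdisj
  have h4 : ((I.map (algebraMap _ (MvPolynomial (Fin n) K))).height : WithBot ℕ∞) ≤
      ringKrullDim (MvPolynomial (Fin n) K) := by
    refine Ideal.height_le_ringKrullDim_of_ne_top ?_
    exact (IsLocalization.isPrime_of_isPrime_disjoint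
      ((nonZeroDivisors B).map (MvPolynomial.C (σ := Fin n))) _ I hI hdisj).ne_top
  rw [h3, MvPolynomial.ringKrullDim_of_isNoetherianRing, ringKrullDim_eq_zero_of_field, zero_add,
    Nat.card_eq_fintype_card, Fintype.card_fin] at h4
  have h5 : Nontrivial (Localization.AtPrime I ⧸
      Ideal.ofList (fs.map (algebraMap _ (Localization.AtPrime I)))) := by
    refine Ideal.Quotient.nontrivial_iff.2 fun h => h1.2 ?_
    rw [smul_eq_mul, h, Ideal.top_mul]
  have h6 : (0 : WithBot ℕ∞) ≤ ringKrullDim (Localization.AtPrime I ⧸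
      Ideal.ofList (fs.map (algebraMap _ (Localization.AtPrime I)))) := ringKrullDim_nonneg_of_nontrivial
  have h7 : (fs.length : WithBot ℕ∞) ≤ n :=
    calc (fs.length : WithBot ℕ∞) = 0 + fs.length := (zero_add _).symm
      _ ≤ _ := by gcongr
      _ = _ := h2
      _ ≤ n := h4
  exact_mod_cast h7

theorem exists_span_range_eq_ofList {R : Type*} [CommRing R] {n : ℕ} (fs : List R)
    (h : fs.length ≤ n) : ∃ f : Fin n → R, Ideal.ofList fs = Ideal.span (Set.range f) := by
  -- A list shorter than n is padded with zero relations, which do not change the ideal but make the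
  -- Jacobian matrix square.
  refine ⟨fun i => fs.getD i 0, le_antisymm (Ideal.span_mono ?_) (Ideal.span_le.2 ?_)⟩
  · intro r hr
    obtain ⟨i, hi, rfl⟩ := List.getElem_of_mem hr
    exact ⟨⟨i, hi.trans_le h⟩, by simp [hi]⟩
  · rintro _ ⟨i, rfl⟩
    by_cases hi : (i : ℕ) < fs.length
    · refine Ideal.subset_span ?_
      simp [hi]
    · simp [hi]

end Presentation

/-! ### Reduction to primes where B is principal. -/

section Codifferent

variable {B A M F : Type*} [CommRing B] [IsDomain B] [IsNoetherianRing B] [IsIntegrallyClosed B]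
    [CommRing A]
    [Field M] [Field F] [Algebra B A] [Algebra B M] [Algebra A F] [Algebra M F] [Algebra B F]
    [IsScalarTower B A F] [IsScalarTower B M F] [IsFractionRing B M]
    [Module.Finite B A]

/-- `B` is a discrete valuation ring or a field at the points of `Spec B` below those associated to
`F` modulo the codifferent. -/
theorem isPrincipalIdealRing_of_annihilator (y : F) (q : Ideal A) [q.IsPrime]
    (hq : ∀ a, a ∈ q ↔ a • y ∈ codifferent B A M F) :
    IsPrincipalIdealRing (Localization.AtPrime (q.under B)) := by
  classical
  set p := q.under B with hp
  have hinj := IsFractionRing.injective B M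
  -- Some trace z = Tr (y a) lies outside B_p. Otherwise a product r ∉ p of denominators for
  -- finitely many generators of A would carry y into the codifferent, so r would lie in q. Since p
  -- multiplies z into B, the normality criterion applies to z.
  obtain ⟨a, ha⟩ : ∃ a : A, ∀ s ∉ p, ∀ b : B, algebraMap B M b ≠
      algebraMap B M s * Algebra.trace M F (y * algebraMap A F a) := by
    by_contra! hcon
    choose s hs b hb using hcon
    obtain ⟨G, hG⟩ := Module.Finite.fg_top (R := B) (M := A)
    let r := ∏ e ∈ G, s e
    have hr : r ∉ p := fun h => by
      obtain ⟨e, _, he⟩ := (Ideal.IsPrime.prod_mem_iff (p := p)).1 h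
      exact hs e he
    let N : Submodule B A := (LinearMap.range (Algebra.linearMap B M)).comap
      (((Algebra.trace M F).restrictScalars B) ∘ₗ (LinearMap.mulLeft B (algebraMap B F r * y)) ∘ₗ
        (IsScalarTower.toAlgHom B A F).toLinearMap)
    have hN : N = ⊤ := by
      rw [← top_le_iff, ← hG, Submodule.span_le]
      intro e he
      refine ⟨(∏ e' ∈ G.erase e, s e') * b e, ?_⟩
      change algebraMap B M _ = Algebra.trace M F (algebraMap B F r * y * algebraMap A F e)
      rw [mul_assoc, IsScalarTower.algebraMap_apply B M F, ← Algebra.smul_def, map_smul, smul_eq_mul,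
        map_mul, hb, ← mul_assoc, ← map_mul, Finset.prod_erase_mul _ _ he]
    apply hr
    change algebraMap B A r ∈ q
    rw [hq]
    intro a
    have : a ∈ N := hN ▸ Submodule.mem_top
    obtain ⟨c, hc⟩ := this
    refine ⟨c, hc.trans ?_⟩
    change Algebra.trace M F (algebraMap B F r * y * algebraMap A F a) = _
    rw [Algebra.smul_def, ← IsScalarTower.algebraMap_apply B A F]
  set z := Algebra.trace M F (y * algebraMap A F a) with hz
  have hpz (b : B) (hb : b ∈ p) : ∃ c : B, algebraMap B M c = algebraMap B M b * z := by
    obtain ⟨c, hc⟩ := (hq (algebraMap B A b)).1 hb a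
    refine ⟨c, hc.trans ?_⟩
    rw [algebraMap_smul, Algebra.smul_def, mul_assoc, IsScalarTower.algebraMap_apply B M F,
      ← Algebra.smul_def, map_smul, smul_eq_mul]
  let _ : Algebra (Localization.AtPrime p) M := IsLocalization.localizationAlgebraOfSubmonoidLe
    _ _ p.primeCompl (nonZeroDivisors B) p.primeCompl_le_nonZeroDivisors
  have _ : IsScalarTower B (Localization.AtPrime p) M :=
    IsLocalization.localization_isScalarTower_of_submonoid_le _ _ p.primeCompl (nonZeroDivisors B)
      p.primeCompl_le_nonZeroDivisors
  have _ : IsFractionRing (Localization.AtPrime p) M :=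
    IsFractionRing.isFractionRing_of_isDomain_of_isLocalization p.primeCompl _ _
  have _ : IsIntegrallyClosed (Localization.AtPrime p) :=
    isIntegrallyClosed_of_isLocalization _ p.primeCompl p.primeCompl_le_nonZeroDivisors
  have _ : IsNoetherianRing (Localization.AtPrime p) :=
    IsLocalization.isNoetherianRing p.primeCompl _ inferInstance
  refine isPrincipalIdealRing_of_maximalIdeal_mul (K := M) z ?_ fun x hx => ?_
  · rintro ⟨w, hw⟩
    obtain ⟨⟨b, s⟩, hbs⟩ := IsLocalization.surj p.primeCompl w
    refine ha s s.2 b ?_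
    have := congrArg (algebraMap (Localization.AtPrime p) M) hbs
    rw [map_mul, hw, ← IsScalarTower.algebraMap_apply, ← IsScalarTower.algebraMap_apply] at this
    rw [← this, mul_comm]
  · obtain ⟨⟨b, s⟩, hbs⟩ := IsLocalization.surj p.primeCompl x
    have hb : b ∈ p := by
      rw [← IsLocalization.AtPrime.to_map_mem_maximal_iff (Localization.AtPrime p) p, ← hbs]
      exact Ideal.mul_mem_right _ _ hx
    obtain ⟨c, hc⟩ := hpz b hb
    have hs0 : algebraMap B M s ≠ 0 :=
      (map_ne_zero_iff _ hinj).2 (nonZeroDivisors.ne_zero (p.primeCompl_le_nonZeroDivisors s.2))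
    refine ⟨IsLocalization.mk' _ c s, mul_left_cancel₀ hs0 ?_⟩
    have h1 := congrArg (algebraMap (Localization.AtPrime p) M) hbs
    rw [map_mul, ← IsScalarTower.algebraMap_apply, ← IsScalarTower.algebraMap_apply] at h1
    have h2 := congrArg (algebraMap (Localization.AtPrime p) M)
      (IsLocalization.mk'_spec' (Localization.AtPrime p) c s)
    rw [map_mul, ← IsScalarTower.algebraMap_apply, ← IsScalarTower.algebraMap_apply] at h2
    rw [h2, hc, ← h1]
    ring

/-- An element lies in the radical of `I` as soon as it lies in all associated primes of `R ⧸ I`. -/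
theorem mem_radical_of_forall_associated {R : Type*} [CommRing R] [IsNoetherianRing R]
    (I : Ideal R) (g : R)
    (h : ∀ (q : Ideal R) (a : R), q.IsPrime → (∀ r, r ∈ q ↔ r * a ∈ I) → I ≤ q → g ∈ q) :
    g ∈ I.radical := by
  rw [← Ideal.sInf_minimalPrimes, Ideal.mem_sInf]
  intro q hq
  have h1 : q ∈ associatedPrimes R (R ⧸ I) := by
    refine Module.associatedPrimes.minimalPrimes_annihilator_subset_associatedPrimes R (R ⧸ I) ?_
    rwa [Ideal.annihilator_quotient]
  obtain ⟨hprime, x, hx⟩ := Submodule.isAssociatedPrime_iff.1 h1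
  obtain ⟨a, rfl⟩ := Ideal.Quotient.mk_surjective x
  refine h q a hprime (fun r => ?_) hq.1.2
  rw [hx, Submodule.mem_colon_singleton, Submodule.mem_bot, ← Ideal.Quotient.eq_zero_iff_mem]
  rfl

end Codifferent

/-- A finite torsion-free module over a principal ideal domain is free, so A is free after
localization at p. -/
theorem exists_dual_family_of_isPrincipalIdealRing {B A : Type*} [CommRing B] [IsDomain B]
    [IsNoetherianRing B] [CommRing A] [IsDomain A] [Algebra B A] [FaithfulSMul B A] [Module.Finite B A]
    (p : Ideal B) [p.IsPrime]
    [IsPrincipalIdealRing (Localization.AtPrime p)] :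
    ∃ s ∉ p, ∃ (k : ℕ) (a : Fin k → A) (φ : Fin k → A →ₗ[B] B),
      ∀ x, s • x = ∑ i, φ i x • a i := by
  have : Module.IsTorsionFree B A := inferInstance
  have : Module.Finite (Localization.AtPrime p) (LocalizedModule p.primeCompl A) :=
    Module.Finite.of_isLocalizedModule p.primeCompl (LocalizedModule.mkLinearMap p.primeCompl A)
  have : Module.IsTorsionFree (Localization.AtPrime p) (LocalizedModule p.primeCompl A) :=
    inferInstance
  have : Module.Free (Localization.AtPrime p) (LocalizedModule p.primeCompl A) :=
    Module.free_of_finite_type_torsion_free'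
  have : Module.FinitePresentation B A := Module.finitePresentation_of_finite B A
  exact exists_dual_family_of_free_localization p.primeCompl

/-! ### Characterization of the codifferent by Jacobian determinants. -/

section Membership

variable {B A M F C : Type*} [CommRing B] [CommRing A] [Field M] [Field F] [CommRing C]
    [Algebra B A] [Algebra B M] [Algebra A F] [Algebra M F] [Algebra B F]
    [IsScalarTower B M F] [Algebra B C] [Algebra C F] [IsScalarTower B A F]

/-- An element which multiplies the Jacobian determinants of a presentation of a neighbourhood `C` of
`q` into `C` lies in the codifferent at `q`, if there is a neighbourhood `C'` of `q` with a
presentation by as many relations as variables and `A` is locally free over `B` at `q`. -/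
theorem exists_smul_mem_codifferent_of_presentation {C' L κ : Type*} [CommRing C'] [IsDomain C']
    [CommRing L] [Field κ]
    [Algebra A C'] [Algebra B C'] [Algebra A L] [Algebra B L] [Algebra C L] [Algebra C' L]
    [Algebra C' F] [Algebra L F] [Algebra A κ] [Algebra B κ] [Algebra C' κ]
    [IsScalarTower B A C'] [IsScalarTower A C' F] [IsScalarTower B C' F] [IsScalarTower B C L]
    [IsScalarTower B C' L] [IsScalarTower C L F] [IsScalarTower C' L F] [IsScalarTower A L F]
    [IsScalarTower B A κ] [IsScalarTower A C' κ] [IsScalarTower B C' κ]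
    [IsFractionRing C' F] [FiniteDimensional M F] [Algebra.IsSeparable M F]
    (S : Submonoid B) [IsLocalization S M]
    [IsLocalizedModule S (IsScalarTower.toAlgHom B A F).toLinearMap] [Module.Finite B A]
    (q : Ideal A) [q.IsPrime] [IsLocalization.AtPrime L q] (hκ : ∀ a ∈ q, algebraMap A κ a = 0)
    (T : Submonoid C) [IsLocalization T L] (T' : Submonoid C') [IsLocalization T' L]
    (h : A) [IsLocalization.Away h C']
    (s : B) (hs : algebraMap B κ s ≠ 0) {r : ℕ} (a : Fin r → A) (φ : Fin r → A →ₗ[B] B)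
    (hφ : ∀ x, s • x = ∑ i, φ i x • a i) {n : ℕ}
    (P : Algebra.Generators B C' (Fin n)) (f : Fin n → MvPolynomial (Fin n) B)
    (hf : P.ker = Ideal.span (Set.range f)) {m : ℕ} (Q : Algebra.Generators B C (Fin m)) (c : F)
    (hc : ∀ f : Fin m → Q.toExtension.ker,
      c * algebraMap C F (Q.jacobianDet fun i => (f i).1) ∈ (algebraMap C F).range) :
    ∃ a ∉ q, a • c ∈ codifferent B A M F := by
  obtain ⟨x, hx, a', ha', hxa⟩ := exists_mem_codifferent_jacobianDet_mul_eq (M := M) (F := F) S κ h s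
    hs a φ hφ P f hf
  obtain ⟨l, hl⟩ := mul_jacobianDet_mem_of_forall (L := L) Q T T' P c hc f
    fun i => hf ▸ Ideal.subset_span ⟨i, rfl⟩
  obtain ⟨⟨b, t⟩, hbt⟩ := IsLocalization.surj q.primeCompl l
  refine ⟨t * a', fun hmem => ?_, ?_⟩
  · rcases Ideal.IsPrime.mem_or_mem ‹_› hmem with h1 | h1
    · exact t.2 h1
    · exact ha' (hκ _ h1)
  · have h1 := congrArg (algebraMap L F) hbt
    rw [map_mul, hl, ← IsScalarTower.algebraMap_apply, ← IsScalarTower.algebraMap_apply] at h1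
    -- With J x = a' and c J = b/t one has t a' c = b x, and neither t nor a' lies in q.
    have h2 : (t * a' : A) • c = b • x := by
      rw [Algebra.smul_def, Algebra.smul_def, map_mul, ← hxa, ← h1]
      ring
    rw [h2]
    exact Submodule.smul_mem _ _ hx

variable [Algebra A C] [IsScalarTower B A C] [IsScalarTower A C F]
    [IsDomain B] [IsNoetherianRing B] [IsDomain A] [IsFractionRing B M]
    [IsFractionRing A F] [FaithfulSMul B A] [Module.Finite B A]

/-- The given neighbourhood A_g and the complete intersection neighbourhood A_h of q are compared in
their common localization A_q; κ is the residue field at q. -/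
theorem exists_smul_mem_codifferent_of_isLocalCompleteIntersection
    [FiniteDimensional M F] [Algebra.IsSeparable M F]
    [IsLocalizedModule (nonZeroDivisors B) (IsScalarTower.toAlgHom B A F).toLinearMap]
    (hlci : IsLocalCompleteIntersection B A) (g : A) [IsLocalization.Away g C]
    {m : ℕ} (Q : Algebra.Generators B C (Fin m)) (c : F)
    (hc : ∀ f : Fin m → Q.toExtension.ker,
      c * algebraMap C F (Q.jacobianDet fun i => (f i).1) ∈ (algebraMap C F).range)
    (q : Ideal A) [q.IsPrime] (hg : g ∉ q)
    [IsPrincipalIdealRing (Localization.AtPrime (q.under B))] :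
    ∃ a ∉ q, a • c ∈ codifferent B A M F := by
  obtain ⟨s, hs, k, a, φ, hφ⟩ := exists_dual_family_of_isPrincipalIdealRing (A := A) (q.under B)
  obtain ⟨h, hh, n, P, fs, hreg, hker⟩ := hlci q inferInstance
  have hpow (x : A) (hx : x ∉ q) : Submonoid.powers x ≤ q.primeCompl :=
    Submonoid.powers_le.2 hx
  have hq0 := q.primeCompl_le_nonZeroDivisors
  have hh0 : Submonoid.powers h ≤ nonZeroDivisors A := (hpow h hh).trans hq0
  let L := Localization.AtPrime q
  let C' := Localization.Away h
  have : IsDomain C' := IsLocalization.isDomain_localization hh0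
  let _ : Algebra C L :=
    IsLocalization.localizationAlgebraOfSubmonoidLe C L (.powers g) q.primeCompl (hpow g hg)
  have : IsScalarTower A C L := IsLocalization.localization_isScalarTower_of_submonoid_le C L
    (.powers g) q.primeCompl (hpow g hg)
  let _ : Algebra C' L :=
    IsLocalization.localizationAlgebraOfSubmonoidLe C' L (.powers h) q.primeCompl (hpow h hh)
  have : IsScalarTower A C' L := IsLocalization.localization_isScalarTower_of_submonoid_le C' L
    (.powers h) q.primeCompl (hpow h hh)
  let _ : Algebra L F :=
    IsLocalization.localizationAlgebraOfSubmonoidLe L F q.primeCompl (nonZeroDivisors A) hq0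
  have : IsScalarTower A L F := IsLocalization.localization_isScalarTower_of_submonoid_le L F
    q.primeCompl (nonZeroDivisors A) hq0
  let _ : Algebra C' F := ((algebraMap L F).comp (algebraMap C' L)).toAlgebra
  have : IsScalarTower C' L F := IsScalarTower.of_algebraMap_eq fun _ => rfl
  let _ : Algebra C' q.ResidueField :=
    ((algebraMap L q.ResidueField).comp (algebraMap C' L)).toAlgebra
  have : IsScalarTower C' L q.ResidueField := IsScalarTower.of_algebraMap_eq fun _ => rfl
  have : IsScalarTower A C' F := IsScalarTower.of_algebraMap_eq fun x => by
    rw [IsScalarTower.algebraMap_apply C' L F, ← IsScalarTower.algebraMap_apply A C' L,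
      ← IsScalarTower.algebraMap_apply A L F]
  have : IsScalarTower A C' q.ResidueField := IsScalarTower.of_algebraMap_eq fun x => by
    rw [IsScalarTower.algebraMap_apply C' L, ← IsScalarTower.algebraMap_apply A C' L,
      ← IsScalarTower.algebraMap_apply A L]
  have : IsScalarTower B C' F := .to₁₃₄ B A C' F
  have : IsScalarTower B C' L := .to₁₃₄ B A C' L
  have : IsScalarTower B C L := .to₁₃₄ B A C L
  have : IsScalarTower B C' q.ResidueField := .to₁₃₄ B A C' _
  have : IsScalarTower C L F := IsScalarTower.of_algebraMap_eq' <|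
    IsLocalization.ringHom_ext (.powers g) <| by
      rw [← IsScalarTower.algebraMap_eq A C F, RingHom.comp_assoc, ← IsScalarTower.algebraMap_eq A C L,
        ← IsScalarTower.algebraMap_eq A L F]
  have : IsFractionRing C' F :=
    IsFractionRing.isFractionRing_of_isDomain_of_isLocalization (.powers h) C' F
  have : FaithfulSMul B C' := (faithfulSMul_iff_algebraMap_injective B C').2 <| by
    rw [IsScalarTower.algebraMap_eq B A C', RingHom.coe_comp]
    exact (IsLocalization.injective C' hh0).comp (FaithfulSMul.algebraMap_injective B A)
  have := IsLocalization.isLocalization_of_submonoid_le C L (.powers g) q.primeCompl (hpow g hg)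
  have := IsLocalization.isLocalization_of_submonoid_le C' L (.powers h) q.primeCompl (hpow h hh)
  obtain ⟨f, hf⟩ := exists_span_range_eq_ofList fs (length_le_of_isRegular P fs hreg hker)
  refine exists_smul_mem_codifferent_of_presentation (L := L) (κ := q.ResidueField)
    (nonZeroDivisors B) q
    (fun x hx => Ideal.algebraMap_residueField_eq_zero.2 hx)
    (q.primeCompl.map (algebraMap A C)) (q.primeCompl.map (algebraMap A C')) h s (fun h0 => hs ?_)
    a φ hφ P f (hker.trans hf) Q c hc
  rw [IsScalarTower.algebraMap_apply B A] at h0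
  exact (Ideal.algebraMap_residueField_eq_zero (I := q)).1 h0

theorem jacobianDet_mul_mem_iff [IsIntegrallyClosed B] [IsScalarTower B C F] [IsDomain C] [IsFractionRing C F]
    [FiniteDimensional M F] [Algebra.IsSeparable M F]
    [IsLocalizedModule (nonZeroDivisors B) (IsScalarTower.toAlgHom B A F).toLinearMap]
    (hlci : IsLocalCompleteIntersection B A) (g : A) [IsLocalization.Away g C]
    {m : ℕ} (Q : Algebra.Generators B C (Fin m)) (c : F) :
    (∀ f : Fin m → Q.toExtension.ker,
      c * algebraMap C F (Q.jacobianDet fun i => (f i).1) ∈ (algebraMap C F).range) ↔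
    ∃ k : ℕ, g ^ k • c ∈ codifferent B A M F := by
  constructor
  · intro hc
    have : IsNoetherianRing A := IsNoetherianRing.of_finite B A
    -- The conductor of c into the codifferent. At an associated prime q of A/𝔞 avoiding g, the
    -- local result gives an element of 𝔞 outside q.
    let 𝔞 : Ideal A := (codifferent B A M F).comap (LinearMap.toSpanSingleton A F c)
    suffices h : g ∈ 𝔞.radical from h
    refine mem_radical_of_forall_associated 𝔞 g fun q a0 hq hqa hle => ?_
    by_contra hg
    have := isPrincipalIdealRing_of_annihilator (B := B) (M := M) (a0 • c) q fun a => by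
      rw [hqa, ← mul_smul]; rfl
    obtain ⟨a, ha, hac⟩ := exists_smul_mem_codifferent_of_isLocalCompleteIntersection
      (M := M) hlci g Q c hc q hg
    exact ha (hle hac)
  · rintro ⟨k, hk⟩ f
    obtain ⟨y, hy⟩ := jacobianDet_mul_mem (IsFractionRing.injective B M) g Q f hk
    obtain ⟨v, hv⟩ := (IsLocalization.Away.algebraMap_pow_isUnit (S := C) g k).exists_left_inv
    rw [← map_pow] at hv
    refine ⟨v * y, ?_⟩
    have hv' : algebraMap C F v * algebraMap A F (g ^ k) = 1 := by
      rw [IsScalarTower.algebraMap_apply A C F, ← map_mul, hv, map_one]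
    rw [map_mul, hy, Algebra.smul_def]
    linear_combination (c * algebraMap C F (Q.jacobianDet fun i => (f i).1)) * hv'

end Membership

/-! ### Rank-one modules in the fraction field, and localization. -/

/-- The extension to a localization of an embedding in the fraction field. -/
theorem injective_liftBaseChange {A C F : Type*} [CommRing A] [CommRing C]
    [Field F] [Algebra C F] [Algebra A C] [Algebra A F]
    [IsScalarTower A C F] {N : Type*} [AddCommMonoid N] [Module A N] (S : Submonoid A)
    [IsLocalization S C] {e : N →ₗ[A] F} (he : Function.Injective e) :
    Function.Injective (e.liftBaseChange C) ∧ ∀ c, c ∈ LinearMap.range (e.liftBaseChange C) ↔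
      ∃ s ∈ S, s • c ∈ LinearMap.range e := by
  have := (isLocalizedModule_iff_isBaseChange S C (TensorProduct.mk A C N 1)).2
    (TensorProduct.isBaseChange A N C)
  have hunit (s : S) : IsUnit (algebraMap A C s) := IsLocalization.map_units C s
  have hsmul (s : A) (z : C ⊗[A] N) : e.liftBaseChange C (s • z) = s • e.liftBaseChange C z := by
    rw [← algebraMap_smul C s z, map_smul, algebraMap_smul]
  refine ⟨fun z w hzw => ?_, fun c => ⟨?_, ?_⟩⟩
  · obtain ⟨⟨y, s⟩, h⟩ := IsLocalizedModule.surj S (TensorProduct.mk A C N 1) z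
    obtain ⟨⟨x, t⟩, h'⟩ := IsLocalizedModule.surj S (TensorProduct.mk A C N 1) w
    have h1 : (t : A) • y = (s : A) • x := he <| by
      have hy : e y = e.liftBaseChange C (s • z) := by rw [h]; simp
      have hx : e x = e.liftBaseChange C (t • w) := by rw [h']; simp
      rw [map_smul, map_smul, hy, hx, Submonoid.smul_def, Submonoid.smul_def, hsmul, hsmul, hzw,
        smul_comm]
    refine ((hunit t).mul (hunit s)).smul_left_cancel.1 ?_
    rw [← map_mul, algebraMap_smul, algebraMap_smul, mul_smul, mul_comm, mul_smul]
    refine Eq.trans (congrArg ((t : A) • ·) h) (Eq.trans ?_ (congrArg ((s : A) • ·) h').symm)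
    change (t : A) • TensorProduct.mk A C N 1 y = (s : A) • TensorProduct.mk A C N 1 x
    rw [← map_smul, ← map_smul, h1]
  · rintro ⟨z, rfl⟩
    obtain ⟨⟨y, s⟩, h⟩ := IsLocalizedModule.surj S (TensorProduct.mk A C N 1) z
    refine ⟨s, s.2, y, ?_⟩
    rw [← hsmul]
    change e y = e.liftBaseChange C (s • z)
    rw [h]; simp
  · rintro ⟨s, hs, y, hy⟩
    obtain ⟨v, hv⟩ := (hunit ⟨s, hs⟩).exists_left_inv
    refine ⟨v ⊗ₜ y, ?_⟩
    rw [LinearMap.liftBaseChange_tmul, hy, ← algebraMap_smul C s c, smul_smul, hv, one_smul]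

section RankOne

variable {C F N : Type*} [CommRing C] [IsDomain C] [Field F] [Algebra C F] [IsFractionRing C F]
  [AddCommMonoid N] [Module C N]

/-- Every y has a nonzero multiple equal to a multiple of x, so the value at x determines a map into
F. This is the source of all uniqueness statements. -/
theorem eq_of_injective_of_apply_eq_one {e : N →ₗ[C] F} (he : Function.Injective e) {x : N}
    (hx : e x = 1) {ψ : N →ₗ[C] F} (hψ : ψ x = 1) : ψ = e := by
  ext y
  obtain ⟨a, b, hb, h⟩ := IsFractionRing.div_surjective (A := C) (e y)
  have hb0 : algebraMap C F b ≠ 0 := IsFractionRing.to_map_ne_zero_of_mem_nonZeroDivisors hb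
  have h1 : b • y = a • x := he <| by
    rw [map_smul, map_smul, hx, ← h, Algebra.smul_def, Algebra.smul_def, mul_one,
      mul_div_cancel₀ _ hb0]
  have h2 := congrArg ψ h1
  rw [map_smul, map_smul, hψ, Algebra.smul_def, Algebra.smul_def, mul_one] at h2
  rw [← h, eq_div_iff hb0, mul_comm, h2]

theorem existsUnique_equiv_of_range_eq {N' : Type*} [AddCommMonoid N'] [Module C N']
    {e : N →ₗ[C] F} (he : Function.Injective e) {x : N} (hx : e x = 1)
    {e' : N' →ₗ[C] F} (he' : Function.Injective e') {x' : N'} (hx' : e' x' = 1)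
    (h : LinearMap.range e = LinearMap.range e') : ∃! ρ : N ≃ₗ[C] N', ρ x = x' := by
  let ρ := (LinearEquiv.ofInjective e he).trans
    ((LinearEquiv.ofEq _ _ h).trans (LinearEquiv.ofInjective e' he').symm)
  have hρ (y : N) : e' (ρ y) = e y :=
    congrArg Subtype.val ((LinearEquiv.ofInjective e' he').apply_symm_apply _)
  refine ⟨ρ, he' ((hρ x).trans (hx.trans hx'.symm)), fun σ hσ => LinearEquiv.ext fun y => he' ?_⟩
  rw [hρ]
  exact LinearMap.congr_fun (eq_of_injective_of_apply_eq_one he hx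
    (ψ := e' ∘ₗ σ.toLinearMap) ((congrArg e' hσ).trans hx')) y

theorem existsUnique_tensor_equiv_of_range_eq {A : Type*} [CommRing A] [Algebra A C] [Algebra A F]
    [IsScalarTower A C F] {N N' : Type*} [AddCommMonoid N] [Module A N] [AddCommMonoid N']
    [Module C N'] (S : Submonoid A) [IsLocalization S C]
    {e : N →ₗ[A] F} (he : Function.Injective e) {x : N} (hx : e x = 1)
    {e' : N' →ₗ[C] F} (he' : Function.Injective e') {x' : N'} (hx' : e' x' = 1)
    (h : ∀ c, c ∈ LinearMap.range e' ↔ ∃ s ∈ S, s • c ∈ LinearMap.range e) :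
    ∃! ρ : C ⊗[A] N ≃ₗ[C] N', ρ (1 ⊗ₜ[A] x) = x' := by
  obtain ⟨h1, h2⟩ := injective_liftBaseChange (C := C) S he
  refine existsUnique_equiv_of_range_eq h1 ?_ he' hx' (Submodule.ext fun c => ?_)
  · rw [LinearMap.liftBaseChange_tmul, hx, one_smul]
  · rw [h2, h]

end RankOne

/-! ### Assembly of the theorem. -/

section Main

variable {B A M F : Type*} [CommRing B] [IsDomain B] [IsNoetherianRing B] [IsIntegrallyClosed B]
    [CommRing A] [IsDomain A]
    [Field M] [Field F] [Algebra B A] [Algebra B M] [Algebra A F] [Algebra M F] [Algebra B F]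
    [IsScalarTower B A F] [IsScalarTower B M F] [IsFractionRing B M] [IsFractionRing A F]
    [FaithfulSMul B A] [Module.Finite B A] [FiniteDimensional M F] [Algebra.IsSeparable M F]
    [IsLocalizedModule (nonZeroDivisors B) (IsScalarTower.toAlgHom B A F).toLinearMap]

/-- The canonical module of a principal open subset of a local complete intersection is the
localization of the codifferent. -/
theorem exists_canonicalEmbedding_codifferent (hlci : IsLocalCompleteIntersection B A) (g : A)
    {C : Type*} [CommRing C] [IsDomain C] [Algebra A C] [Algebra B C] [IsScalarTower B A C]
    [Algebra C F] [IsScalarTower A C F] [IsScalarTower B C F] [IsFractionRing C F]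
    [IsLocalization.Away g C] {m : ℕ} (Q : Algebra.Generators B C (Fin m)) :
    ∃ e : CanonicalModule Q →ₗ[C] F, Function.Injective e ∧ e (canonicalElement Q) = 1 ∧
      ∀ c : F, c ∈ LinearMap.range e ↔ ∃ k : ℕ, g ^ k • c ∈ codifferent B A M F := by
  have : Algebra.FormallyEtale B M := .of_isLocalization (nonZeroDivisors B)
  have : Algebra.FormallyEtale M F := .of_isSeparable M F
  have : Algebra.FormallyEtale B F := .comp B M F
  obtain ⟨e, he, he1, hr⟩ := exists_canonicalEmbedding Q F
  exact ⟨e, he, he1, fun c => (hr c).trans (jacobianDet_mul_mem_iff hlci g Q c)⟩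

theorem exists_canonicalEmbedding_range_eq (hlci : IsLocalCompleteIntersection B A) {n : ℕ}
    (P : Algebra.Generators B A (Fin n)) :
    ∃ e : CanonicalModule P →ₗ[A] F, Function.Injective e ∧ e (canonicalElement P) = 1 ∧
      LinearMap.range e = codifferent B A M F := by
  -- The global statement is the case g = 1, where powers of g act trivially.
  have : IsLocalization.Away (1 : A) A :=
    IsLocalization.away_of_isUnit_of_bijective A isUnit_one Function.bijective_id
  obtain ⟨e, he, he1, hr⟩ :=
    exists_canonicalEmbedding_codifferent (M := M) (F := F) hlci 1 P
  exact ⟨e, he, he1, Submodule.ext fun c => (hr c).trans (by simp)⟩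

theorem existsUnique_canonicalModule_equiv_codifferent (hlci : IsLocalCompleteIntersection B A)
    {n : ℕ} (P : Algebra.Generators B A (Fin n)) :
    ∃! e : CanonicalModule P ≃ₗ[A] codifferent B A M F, (e (canonicalElement P) : F) = 1 := by
  obtain ⟨e, he, he1, hr⟩ := exists_canonicalEmbedding_range_eq (M := M) (F := F) hlci P
  have h1 : (1 : F) ∈ codifferent B A M F := hr ▸ ⟨_, he1⟩
  obtain ⟨ρ, hρ, huniq⟩ := existsUnique_equiv_of_range_eq (C := A) (e := e) he he1
    (e' := (codifferent B A M F).subtype) Subtype.val_injective (x' := ⟨1, h1⟩) rfl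
    (hr.trans (Submodule.range_subtype _).symm)
  exact ⟨ρ, congrArg Subtype.val hρ, fun σ hσ => huniq σ (Subtype.ext hσ)⟩

end Main

theorem existsUnique_localization_canonicalModule_equiv_of_isFractionRing {B A : Type*} (M F : Type*) [CommRing B]
    [IsDomain B] [IsNoetherianRing B] [IsIntegrallyClosed B] [CommRing A] [IsDomain A]
    [Field M] [Field F] [Algebra B A] [Algebra B M] [Algebra A F] [Algebra M F] [Algebra B F]
    [IsScalarTower B A F] [IsScalarTower B M F] [IsFractionRing B M] [IsFractionRing A F]
    [FaithfulSMul B A] [Module.Finite B A] [FiniteDimensional M F] [Algebra.IsSeparable M F]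
    [IsLocalizedModule (nonZeroDivisors B) (IsScalarTower.toAlgHom B A F).toLinearMap]
    (hlci : IsLocalCompleteIntersection B A)
    {n : ℕ} (P : Algebra.Generators B A (Fin n)) (g : A) (C : Type*) [CommRing C] [Algebra A C]
    [Algebra B C] [IsScalarTower B A C] [IsLocalization.Away g C] [IsDomain C]
    [Algebra C F] [IsScalarTower A C F] [IsScalarTower B C F] [IsFractionRing C F] {m : ℕ}
    (Q : Algebra.Generators B C (Fin m)) :
    ∃! ρ : C ⊗[A] CanonicalModule P ≃ₗ[C] CanonicalModule Q,
      ρ (1 ⊗ₜ[A] canonicalElement P) = canonicalElement Q := by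
  obtain ⟨e, he, he1, hr⟩ := exists_canonicalEmbedding_range_eq (M := M) (F := F) hlci P
  obtain ⟨e', he', he1', hr'⟩ := exists_canonicalEmbedding_codifferent (M := M) (F := F) hlci g Q
  exact existsUnique_tensor_equiv_of_range_eq (.powers g) he he1 he' he1' fun c => by
    rw [hr', hr]
    exact ⟨fun ⟨k, h⟩ => ⟨_, ⟨k, rfl⟩, h⟩, by
      rintro ⟨_, ⟨k, rfl⟩, h⟩
      exact ⟨k, h⟩⟩

theorem existsUnique_localization_canonicalModule_equiv {B A : Type*} (M F : Type*) [CommRing B]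
    [IsDomain B] [IsNoetherianRing B] [IsIntegrallyClosed B] [CommRing A] [IsDomain A]
    [Field M] [Field F] [Algebra B A] [Algebra B M] [Algebra A F] [Algebra M F] [Algebra B F]
    [IsScalarTower B A F] [IsScalarTower B M F] [IsFractionRing B M] [IsFractionRing A F]
    [FaithfulSMul B A] [Module.Finite B A] [FiniteDimensional M F] [Algebra.IsSeparable M F]
    [IsLocalizedModule (nonZeroDivisors B) (IsScalarTower.toAlgHom B A F).toLinearMap]
    (hlci : IsLocalCompleteIntersection B A)
    {n : ℕ} (P : Algebra.Generators B A (Fin n)) (g : A) (C : Type*) [CommRing C] [Algebra A C]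
    [Algebra B C] [IsScalarTower B A C] [IsLocalization.Away g C] {m : ℕ}
    (Q : Algebra.Generators B C (Fin m)) :
    ∃! ρ : C ⊗[A] CanonicalModule P ≃ₗ[C] CanonicalModule Q,
      ρ (1 ⊗ₜ[A] canonicalElement P) = canonicalElement Q := by
  -- For g = 0 the localization is the zero ring and does not embed in F, but all modules over it
  -- are trivial.
  by_cases hg : g = 0
  · have : Subsingleton C :=
      IsLocalization.subsingleton (M := .powers g) (hg ▸ Submonoid.mem_powers g)
    have : Subsingleton (CanonicalModule Q) := Module.subsingleton C _
    have : Subsingleton (C ⊗[A] CanonicalModule P) := Module.subsingleton C _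
    exact ⟨0, Subsingleton.elim _ _, fun _ _ => LinearEquiv.ext fun _ => Subsingleton.elim _ _⟩
  have hg0 : Submonoid.powers g ≤ nonZeroDivisors A := powers_le_nonZeroDivisors_of_noZeroDivisors hg
  have : IsDomain C := IsLocalization.isDomain_of_le_nonZeroDivisors C hg0
  let _ : Algebra C F :=
    IsLocalization.localizationAlgebraOfSubmonoidLe C F (.powers g) (nonZeroDivisors A) hg0
  have : IsScalarTower A C F := IsLocalization.localization_isScalarTower_of_submonoid_le C F
    (.powers g) (nonZeroDivisors A) hg0
  have : IsScalarTower B C F := .to₁₃₄ B A C F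
  have : IsFractionRing C F :=
    IsFractionRing.isFractionRing_of_isDomain_of_isLocalization (.powers g) C F
  exact existsUnique_localization_canonicalModule_equiv_of_isFractionRing M F hlci P g C Q

end

theorem mainTheorem10
    (B A M F : Type*) [CommRing B] [IsDomain B] [IsNoetherianRing B] [IsIntegrallyClosed B]
    [CharZero B]
    [CommRing A] [IsDomain A] [IsIntegrallyClosed A]
    [Field M] [Field F] [Algebra B A] [Algebra B M] [Algebra A F] [Algebra M F] [Algebra B F]
    [IsScalarTower B A F] [IsScalarTower B M F] [IsFractionRing B M] [IsFractionRing A F]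
    [FaithfulSMul B A] [Module.Finite B A]
    (hlci : IsLocalCompleteIntersection B A)
    (n : ℕ) (P : Algebra.Generators B A (Fin n)) :
    -- the codifferent is the dualizing module `Hom_B(A, B)`, through the trace pairing
    (∃ c : codifferent B A M F ≃ₗ[A] DualizingModule B A,
      ∀ (x : codifferent B A M F) (a : A),
        algebraMap B M (c x a) = Algebra.trace M F ((x : F) * algebraMap A F a)) ∧
    -- the canonical module is the codifferent, the canonical element corresponding to `1`
    (∃! e : CanonicalModule P ≃ₗ[A] codifferent B A M F, (e (canonicalElement P) : F) = 1) ∧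
    -- the canonical module is, on each principal open set, the one computed there from any
    -- local presentation, compatibly with the canonical elements
    (∀ (g : A) (m : ℕ) (Q : Algebra.Generators B (Localization.Away g) (Fin m)),
      ∃! ρ : Localization.Away g ⊗[A] CanonicalModule P ≃ₗ[Localization.Away g]
          CanonicalModule Q,
        ρ (1 ⊗ₜ[A] canonicalElement P) = canonicalElement Q) := by
  have hinj := IsFractionRing.injective B M
  have : CharZero M := charZero_of_injective_algebraMap hinj
  -- A is normal and finite over B, hence the integral closure of B in F; so F arises from A by
  -- inverting the nonzero elements of B alone.
  have : IsIntegralClosure A B F := inferInstance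
  have : Algebra.IsAlgebraic M F := isAlgebraic_of_isFractionRing B A M F
  have : IsLocalization (Algebra.algebraMapSubmonoid A (nonZeroDivisors B)) F :=
    IsIntegralClosure.isLocalization B M F A
  have : IsLocalizedModule (nonZeroDivisors B) (IsScalarTower.toAlgHom B A F).toLinearMap :=
    isLocalizedModule_iff_isLocalization.2 this
  have : FiniteDimensional M F := Module.Finite.of_isLocalization B A (nonZeroDivisors B)
  exact ⟨exists_codifferentEquiv (nonZeroDivisors B) hinj,
    existsUnique_canonicalModule_equiv_codifferent hlci P,
    fun g _ Q => existsUnique_localization_canonicalModule_equiv M F hlci P g _ Q⟩
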